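/- Let $(x_n)_{n\in\mathbb Z}$ be a real, zero-mean, stationary Gaussian process with spectral density $S$, i.e. $\mathrm{Cov}(x_n,x_m)=\int_{-1/2}^{1/2}e^{2\pi i(n-m)g}S(g)\,dg$ for all $n,m$, where $S$ is real and twice continuously differentiable on $[-\tfrac12,\tfrac12]$. For orthonormal vectors (tapers) $v^{(1)},\dots,v^{(K)}\in\mathbb R^N$ and real weights $\mu_1,\dots,\mu_K$ with $\sum_{k=1}^K\mu_k=1$, consider the multitaper estimate $$\widehat S(f)=\sum_{k=1}^K\mu_k\Bigl|\sum_{n=1}^N v^{(k)}_n x_n e^{-2\pi i nf}\Bigr|^2,$$ and put $V^{(k)}(h)=\sum_{n=1}^N v^{(k)}_n e^{-2\pi i nh}$, $\lambda_k=\int_{-1/2}^{1/2}h^2|V^{(k)}(h)|^2\,dh$ (the local bias of the $k$-th taper). For $\delta>0$ call the tapers with these weights $\delta$-localized if $\lambda_k\le\delta$ for all $k$ and $$\sum_{k=1}^K|\mu_k|\int_{\delta<|h|\le1/2}h^2|V^{(k)}(h)|^2\,dh\ \le\ \delta\sum_{k=1}^K|\mu_k|\lambda_k .$$ Theorem. For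 $K/N\to0$ and tapers localized near zero frequency, uniformly over frequencies away from $0$ and $\pm\tfrac12$, $$E\bigl[(\widehat S(f)-S(f))^2\bigr]=\mathrm{Bias}^2+\mathrm{Variance}\ \approx\ \Bigl[\tfrac12S''(f)\sum_{k=1}^K\lambda_k\mu_k\Bigr]^2+S(f)^2\sum_{k=1}^K\mu_k^2 .$$ Precisely: for every $\eta>0$ and $\varepsilon>0$ there is $\delta>0$ such that for all $N,K$ with $K\le\delta N$, all orthonormal tapers $v^{(1)},\dots,v^{(K)}\in\mathbb R^N$, all real weights with $\sum_k\mu_k=1$ for which the tapers are $\delta$-localized, and all $f$ with $\eta\le|f|\le\tfrac12-\eta$, the expected square error is finite, is equal to $\bigl(E\widehat S(f)-S(f)\bigr)^2+\mathrm{Var}\,\widehat S(f)$, and satisfies $$\left|E\bigl[(\widehat S(f)-S(f))^2\bigr]-\Bigl[\tfrac12S''(f)\sum_{k=1}^K\lambda_k\mu_k\Bigr]^2-S(f)^2\sum_{k=1}^K\mu_k^2\right|\ \le\ \varepsilon\left[\Bigl(\sum_{k=1}^K\lambda_k|\mu_k|\Bigr)^2+\sum_{k=1}^K\mu_k^2\right].$$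 For the sinusoidal tapers $v^{(k)}_n=\sqrt{2/(N+1)}\,\sin\bigl(\pi kn/(N+1)\bigr)$, $1\le k\le K$, the same conclusion holds for all $N,K$ with $K\le\delta N$ and all real weights with $\sum_k\mu_k=1$, without any localization hypothesis. -/

import Mathlib

open MeasureTheory ProbabilityTheory Set
open scoped ProbabilityTheory Real

noncomputable section

namespace Multitaper

/-- `x` is a real, zero-mean, stationary Gaussian process indexed by the integers, with spectral
density `S` on the frequency band `[-1/2, 1/2]`: the covariance of `x n` and `x m` is the Fourier
coefficient of `S` at the lag `n - m`. In particular it depends on `n - m` only, so that all finite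
dimensional laws of `x`, being centered Gaussian, are invariant under time shifts. -/
structure IsStationaryGaussian {Ω : Type*} [MeasurableSpace Ω] (P : Measure Ω)
    (x : ℤ → Ω → ℝ) (S : ℝ → ℝ) : Prop where
  gaussian : IsGaussianProcess x P
  mean_zero : ∀ n : ℤ, ∫ ω, x n ω ∂P = 0
  covariance_eq : ∀ n m : ℤ, ((cov[x n, x m; P] : ℝ) : ℂ) =
    ∫ g in (-(1 / 2 : ℝ))..(1 / 2),
      Complex.exp (2 * π * Complex.I * ((n - m : ℤ) : ℂ) * (g : ℂ)) * ((S g : ℝ) : ℂ)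

/-- The Fourier transform `∑ₙ aₙ e^{-2πinf}` (with `n = 1, …, N`) of a finite real sequence; the
entry of `a` at time `n` is `a ⟨n - 1, _⟩`. -/
def fourier {N : ℕ} (a : Fin N → ℝ) (f : ℝ) : ℂ :=
  ∑ n : Fin N, (a n : ℂ) *
    Complex.exp (-(2 * π * Complex.I * (((n : ℕ) + 1 : ℕ) : ℂ) * (f : ℂ)))

/-- The multitaper spectral estimate at frequency `f` from the data `x₁, …, x_N`, with tapers
`v k` and weights `μ k`: `∑ₖ μₖ |∑ₙ vₙ⁽ᵏ⁾ xₙ e^{-2πinf}|²`. -/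
def estimate {Ω : Type*} {N K : ℕ} (x : ℤ → Ω → ℝ) (v : Fin K → EuclideanSpace ℝ (Fin N))
    (μ : Fin K → ℝ) (f : ℝ) (ω : Ω) : ℝ :=
  ∑ k : Fin K, μ k * ‖fourier (fun n : Fin N => v k n * x ((n : ℕ) + 1 : ℕ) ω) f‖ ^ 2

/-- The spectral window of a taper: its Fourier transform. -/
def window {N : ℕ} (v : EuclideanSpace ℝ (Fin N)) (h : ℝ) : ℂ :=
  fourier (fun n : Fin N => v n) h

/-- The local bias `∫_{-1/2}^{1/2} h² |V(h)|² dh` of a taper. -/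
def localBias {N : ℕ} (v : EuclideanSpace ℝ (Fin N)) : ℝ :=
  ∫ h in Icc (-(1 / 2 : ℝ)) (1 / 2), h ^ 2 * ‖window v h‖ ^ 2

/-- The part `∫_{δ < |h| ≤ 1/2} h² |V(h)|² dh` of the local bias that comes from the frequencies
farther than `δ` from zero. -/
def localBiasBeyond {N : ℕ} (v : EuclideanSpace ℝ (Fin N)) (δ : ℝ) : ℝ :=
  ∫ h in Icc (-(1 / 2 : ℝ)) (1 / 2) \ Icc (-δ) δ, h ^ 2 * ‖window v h‖ ^ 2

/-- The tapers `v k` with weights `μ k` are localized near zero frequency to precision `δ`: every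
local bias is at most `δ`, and at most the fraction `δ` of the weighted local bias comes from
frequencies farther than `δ` from zero. -/
def IsLocalized {N K : ℕ} (v : Fin K → EuclideanSpace ℝ (Fin N)) (μ : Fin K → ℝ) (δ : ℝ) : Prop :=
  (∀ k, localBias (v k) ≤ δ) ∧
    ∑ k, |μ k| * localBiasBeyond (v k) δ ≤ δ * ∑ k, |μ k| * localBias (v k)

/-- The first `K` sinusoidal tapers `vₙ⁽ᵏ⁾ = √(2/(N+1)) sin(πkn/(N+1))`, `1 ≤ k ≤ K`,
`1 ≤ n ≤ N`. -/
def sinusoidalTapers (N K : ℕ) (k : Fin K) : EuclideanSpace ℝ (Fin N) :=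
  WithLp.toLp 2 fun n : Fin N =>
    √(2 / ((N : ℝ) + 1)) * Real.sin (π * ((k : ℝ) + 1) * ((n : ℝ) + 1) / ((N : ℝ) + 1))

/-- The leading order loss `[½ S''(f) ∑ λₖ μₖ]² + S(f)² ∑ μₖ²`. -/
def leadingLoss {N K : ℕ} (S : ℝ → ℝ) (v : Fin K → EuclideanSpace ℝ (Fin N)) (μ : Fin K → ℝ)
    (f : ℝ) : ℝ :=
  (1 / 2 * iteratedDeriv 2 S f * ∑ k, localBias (v k) * μ k) ^ 2 + S f ^ 2 * ∑ k, μ k ^ 2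

/-- The expected square error of the multitaper estimate at `f` is finite, equals the squared bias
plus the variance, and agrees with `leadingLoss` up to an error of `ε` times the natural size
`(∑ λₖ |μₖ|)² + ∑ μₖ²` of its two terms. -/
def LossApprox {Ω : Type*} [MeasurableSpace Ω] {N K : ℕ} (P : Measure Ω) (x : ℤ → Ω → ℝ)
    (S : ℝ → ℝ) (v : Fin K → EuclideanSpace ℝ (Fin N)) (μ : Fin K → ℝ) (f ε : ℝ) : Prop :=
  Integrable (fun ω => (estimate x v μ f ω - S f) ^ 2) P ∧
  ∫ ω, (estimate x v μ f ω - S f) ^ 2 ∂P =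
    (∫ ω, estimate x v μ f ω ∂P - S f) ^ 2 + Var[estimate x v μ f; P] ∧
  |∫ ω, (estimate x v μ f ω - S f) ^ 2 ∂P - leadingLoss S v μ f| ≤
    ε * ((∑ k, localBias (v k) * |μ k|) ^ 2 + ∑ k, μ k ^ 2)

end Multitaper

end

noncomputable section

namespace Multitaper

/-! The square error splits into squared bias and variance. Write `J_k = ∑ v_n x_n e^{-2πinf}` for
the `k`-th tapered transform. Its real and imaginary parts are jointly Gaussian, so Isserlis'
formula gives `E Ŝ = ∑ μ_k A_kk` and `Var Ŝ = ∑ μ_k μ_l (|A_kl|² + |B_kl|²)`, where `A_kl = E[J_k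
conj J_l]` (`spectralForm`) and `B_kl = E[J_k J_l]` (`pseudoSpectralForm`) are integrals of `S`
against products of shifted windows.

Bias: `A_kk` averages `S` against `|V_k(f - g)|²`. Around `f`, `S` is expanded as a constant, a
multiple of `sin (2π(f - g))` and half of `S''(f)` times the squared circular distance. The sine is
odd and periodic, so it integrates to zero; the quadratic term gives the local bias. The remainder
is small relative to the local bias near `f`, and localization controls it farther out
(`exists_uniform_expansion`, `abs_spectralForm_self_sub_le`).

Variance: by Parseval the constant part of `S` contributes `S(f)` times the identity matrix to `A`.
The error must be small relative to `∑ μ_k²` without a factor `K`. Bessel's inequality bounds each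
row and column of squared entries by a single window energy, and a Schur test turns this into a
bound on the double sum (`abs_sum_spectralForm_sub_le`). For `B`, the two windows peak at `g = f`
and `g = -f`, which are separated modulo one; splitting `S` into a part vanishing at each peak makes
either the rows or the columns small (`sum_pseudoSpectralForm_le`).

Sinusoidal tapers solve a three term recurrence with zero boundary values, so multiplying the window
by `2 cos 2πh - 2 cos θ` leaves only two boundary terms. This gives its `sin² πh` moment exactly and
bounds its `sin⁴ πh` moment; Chebyshev's inequality then yields localization
(`isLocalized_sinusoidalTapers`). -/

/-! ### Gaussian fourth moments and Isserlis' formula -/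

/-- The fourth moment of a centered Gaussian distribution. -/
theorem integral_pow_four_gaussianReal (v : NNReal) :
    ∫ x, x ^ 4 ∂(gaussianReal 0 v) = 3 * (v : ℝ) ^ 2 := by
  have h0 : (0 : ℝ) ∈ interior (integrableExpSet id (gaussianReal 0 v)) := by
    have : integrableExpSet id (gaussianReal 0 v) = Set.univ := by
      ext t
      simp only [integrableExpSet, id_eq, mem_ofPred_eq, mem_univ, iff_true]
      exact integrable_exp_mul_gaussianReal t
    simp [this]
  have h1 := iteratedDeriv_mgf_zero h0 4
  have hm : mgf id (gaussianReal 0 v) = fun t => Real.exp (v * t ^ 2 / 2) := by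
    rw [mgf_id_gaussianReal]; ext t; simp
  have hE : ∀ t : ℝ, HasDerivAt (fun t : ℝ => Real.exp (v * t ^ 2 / 2))
      (v * t * Real.exp (v * t ^ 2 / 2)) t := fun t => by
    have h2 := ((((hasDerivAt_id t).pow 2).const_mul (v : ℝ)).div_const 2).exp
    refine h2.congr_deriv ?_
    simp; ring
  have d1 : deriv (fun t : ℝ => Real.exp (v * t ^ 2 / 2)) =
      fun t => v * t * Real.exp (v * t ^ 2 / 2) := funext fun t => (hE t).deriv
  have d2 : deriv (fun t : ℝ => v * t * Real.exp (v * t ^ 2 / 2)) =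
      fun t => (v + v ^ 2 * t ^ 2) * Real.exp (v * t ^ 2 / 2) := funext fun t => by
    have h2 := ((hasDerivAt_id t).const_mul (v : ℝ)).mul (hE t)
    refine (h2.congr_deriv ?_).deriv
    simp; ring
  have d3 : deriv (fun t : ℝ => (v + v ^ 2 * t ^ 2) * Real.exp (v * t ^ 2 / 2)) =
      fun t => (3 * v ^ 2 * t + v ^ 3 * t ^ 3) * Real.exp (v * t ^ 2 / 2) := funext fun t => by
    have h2 := ((((hasDerivAt_id t).pow 2).const_mul ((v : ℝ) ^ 2)).const_add (v : ℝ)).mul (hE t)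
    refine (h2.congr_deriv ?_).deriv
    simp; ring
  have d4 : deriv (fun t : ℝ => (3 * v ^ 2 * t + v ^ 3 * t ^ 3) * Real.exp (v * t ^ 2 / 2)) 0 =
      3 * (v : ℝ) ^ 2 := by
    have h2 := (((hasDerivAt_id (0 : ℝ)).const_mul (3 * (v : ℝ) ^ 2)).add
      (((hasDerivAt_id (0 : ℝ)).pow 3).const_mul ((v : ℝ) ^ 3))).fun_mul (hE 0)
    refine (h2.congr_deriv ?_).deriv
    simp
  rw [hm, iteratedDeriv_succ, iteratedDeriv_succ, iteratedDeriv_succ, iteratedDeriv_one, d1, d2, d3,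
    d4] at h1
  simpa using h1.symm

theorem integral_pow_four_of_hasGaussianLaw {Ω : Type*} [MeasurableSpace Ω] {P : Measure Ω}
    {X : Ω → ℝ} (hX : HasGaussianLaw X P)
    (h0 : ∫ ω, X ω ∂P = 0) : ∫ ω, X ω ^ 4 ∂P = 3 * Var[X; P] ^ 2 := by
  have h := hX.map_eq_gaussianReal
  rw [h0] at h
  have h1 := integral_map (μ := P) (f := fun x : ℝ => x ^ 4) hX.aemeasurable (by fun_prop)
  rw [← h1, h, integral_pow_four_gaussianReal, Real.coe_toNNReal _ (variance_nonneg _ _)]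

theorem memLp_sq_of_hasGaussianLaw {Ω : Type*} [MeasurableSpace Ω] {P : Measure Ω}
    {X : Ω → ℝ} (hX : HasGaussianLaw X P) :
    MemLp (fun ω => X ω ^ 2) 2 P := by
  have h : MemLp X (2 * 2) P := hX.memLp (by norm_num)
  have h4 : MemLp X 4 P := by convert h using 1; norm_num
  have := MemLp.mul (p := 4) (q := 4) (r := 2) h4 h4 (hpqr := ⟨by
    rw [← two_mul, show (4 : ENNReal) = 2 * 2 by norm_num,
      ENNReal.mul_inv (by norm_num) (by norm_num), ← mul_assoc,
      ENNReal.mul_inv_cancel (by norm_num) (by norm_num), one_mul]⟩)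
  exact this.congr_norm (this.1.congr (.of_forall fun ω => (pow_two (X ω)).symm))
    (.of_forall fun ω => by simp [pow_two])

/-- Isserlis' formula for the covariance of the squares of two jointly Gaussian variables. -/
theorem covariance_sq_sq_of_hasGaussianLaw {Ω : Type*} [MeasurableSpace Ω] {P : Measure Ω}
    [IsProbabilityMeasure P] {U W : Ω → ℝ}
    (h : HasGaussianLaw (fun ω => (U ω, W ω)) P)
    (hU0 : ∫ ω, U ω ∂P = 0) (hW0 : ∫ ω, W ω ∂P = 0) :
    cov[fun ω => U ω ^ 2, fun ω => W ω ^ 2; P] = 2 * cov[U, W; P] ^ 2 := by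
  have hU := h.fst
  have hW := h.snd
  have hadd := h.add
  have hsub := h.sub
  have hU2 := hU.memLp_two
  have hW2 := hW.memLp_two
  have eU := integral_pow_four_of_hasGaussianLaw hU hU0
  have eW := integral_pow_four_of_hasGaussianLaw hW hW0
  have ea := integral_pow_four_of_hasGaussianLaw hadd (by
    simp only [Pi.add_apply]; rw [integral_add hU.integrable hW.integrable, hU0, hW0, add_zero])
  have es := integral_pow_four_of_hasGaussianLaw hsub (by
    simp only [Pi.sub_apply]; rw [integral_sub hU.integrable hW.integrable, hU0, hW0, sub_zero])
  rw [variance_add hU2 hW2] at ea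
  rw [variance_sub hU2 hW2] at es
  have qU := memLp_sq_of_hasGaussianLaw hU
  have qW := memLp_sq_of_hasGaussianLaw hW
  have iU : Integrable (fun ω => U ω ^ 4) P := by
    have := qU.integrable_sq
    simpa [← pow_mul] using this
  have iW : Integrable (fun ω => W ω ^ 4) P := by
    have := qW.integrable_sq
    simpa [← pow_mul] using this
  have ia : Integrable (fun ω => (U + W) ω ^ 4) P := by
    have := (memLp_sq_of_hasGaussianLaw hadd).integrable_sq
    simpa [← pow_mul] using this
  have is : Integrable (fun ω => (U - W) ω ^ 4) P := by
    have := (memLp_sq_of_hasGaussianLaw hsub).integrable_sq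
    simpa [← pow_mul] using this
  have ias : Integrable (fun ω => (U + W) ω ^ 4 + (U - W) ω ^ 4) P := ia.add is
  have iasU : Integrable (fun ω => (U + W) ω ^ 4 + (U - W) ω ^ 4 - 2 * U ω ^ 4) P :=
    ias.sub (iU.const_mul 2)
  -- Polarization: `12 U²W² = (U+W)⁴ + (U-W)⁴ - 2U⁴ - 2W⁴`, so fourth moments of single Gaussian
  -- variables suffice.
  have key : ∫ ω, U ω ^ 2 * W ω ^ 2 ∂P = (∫ ω, (U + W) ω ^ 4 ∂P + ∫ ω, (U - W) ω ^ 4 ∂P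
      - 2 * ∫ ω, U ω ^ 4 ∂P - 2 * ∫ ω, W ω ^ 4 ∂P) / 12 := by
    rw [← integral_const_mul, ← integral_const_mul, ← integral_add ia is,
      ← integral_sub ias (iU.const_mul 2),
      ← integral_sub iasU (iW.const_mul 2), ← integral_div]
    refine integral_congr_ae (.of_forall fun ω => ?_)
    simp only [Pi.add_apply, Pi.sub_apply]
    ring
  have vU : ∫ ω, U ω ^ 2 ∂P = Var[U; P] := by
    rw [variance_eq_sub hU2, hU0]; simp
  have vW : ∫ ω, W ω ^ 2 ∂P = Var[W; P] := by
    rw [variance_eq_sub hW2, hW0]; simp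
  rw [covariance_eq_sub qU qW]
  simp only [Pi.mul_apply]
  rw [key, ea, es, eU, eW, vU, vW]
  ring

/-! ### Mean and variance of the estimate through covariances of linear statistics -/

/-- The linear statistic `∑ₙ aₙ xₙ` of the data `x₁, …, x_N`. -/
def linearStatistic {Ω : Type*} {N : ℕ} (x : ℤ → Ω → ℝ) (a : Fin N → ℝ) (ω : Ω) : ℝ :=
  ∑ n : Fin N, a n * x ((n : ℕ) + 1 : ℕ) ω

theorem isGaussianProcess_linearStatistic {Ω : Type*} [MeasurableSpace Ω] {P : Measure Ω}
    {x : ℤ → Ω → ℝ} (hx : IsGaussianProcess x P) (N : ℕ) :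
    IsGaussianProcess (fun a : Fin N → ℝ => linearStatistic x a) P := by
  classical
  refine hx.of_isGaussianProcess fun a =>
    ⟨Finset.univ.image fun n : Fin N => (((n : ℕ) + 1 : ℕ) : ℤ),
      ∑ n : Fin N, a n • ContinuousLinearMap.proj (R := ℝ)
        ⟨(((n : ℕ) + 1 : ℕ) : ℤ), Finset.mem_image_of_mem _ (Finset.mem_univ n)⟩, fun ω => ?_⟩
  simp [linearStatistic]

theorem integral_linearStatistic {Ω : Type*} [MeasurableSpace Ω] {P : Measure Ω}
    {x : ℤ → Ω → ℝ} (hx : IsGaussianProcess x P)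
    (h0 : ∀ n, ∫ ω, x n ω ∂P = 0) {N : ℕ} (a : Fin N → ℝ) :
    ∫ ω, linearStatistic x a ω ∂P = 0 := by
  unfold linearStatistic
  rw [integral_finsetSum _ fun n _ => ((hx.hasGaussianLaw_eval _).integrable.const_mul _)]
  simp [integral_const_mul, h0]

theorem covariance_linearStatistic {Ω : Type*} [MeasurableSpace Ω] {P : Measure Ω}
    [IsProbabilityMeasure P] {x : ℤ → Ω → ℝ}
    (hx : IsGaussianProcess x P) {N : ℕ} (a b : Fin N → ℝ) :
    cov[linearStatistic x a, linearStatistic x b; P] =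
      ∑ n : Fin N, ∑ m : Fin N, a n * b m *
        cov[x ((n : ℕ) + 1 : ℕ), x ((m : ℕ) + 1 : ℕ); P] := by
  unfold linearStatistic
  rw [covariance_fun_sum_fun_sum (fun n => (hx.hasGaussianLaw_eval _).memLp_two.const_mul _)
    (fun n => (hx.hasGaussianLaw_eval _).memLp_two.const_mul _)]
  refine Finset.sum_congr rfl fun n _ => Finset.sum_congr rfl fun m _ => ?_
  rw [covariance_const_mul_left, covariance_const_mul_right]
  ring

/-- The taper modulated by a cosine. -/
def cosTaper {N : ℕ} (v : EuclideanSpace ℝ (Fin N)) (f : ℝ) (n : Fin N) : ℝ :=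
  v n * Real.cos (2 * π * ((n : ℕ) + 1 : ℕ) * f)

/-- The taper modulated by a sine. -/
def sinTaper {N : ℕ} (v : EuclideanSpace ℝ (Fin N)) (f : ℝ) (n : Fin N) : ℝ :=
  v n * Real.sin (2 * π * ((n : ℕ) + 1 : ℕ) * f)

theorem exp_neg_two_pi_mul (n : ℕ) (f : ℝ) :
    Complex.exp (-(2 * π * Complex.I * (n : ℂ) * (f : ℂ))) =
      (Real.cos (2 * π * n * f) : ℂ) - (Real.sin (2 * π * n * f) : ℂ) * Complex.I := by
  have : -(2 * π * Complex.I * (n : ℂ) * (f : ℂ)) = ((-(2 * π * n * f) : ℝ) : ℂ) * Complex.I := by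
    push_cast; ring
  rw [this, Complex.exp_mul_I, ← Complex.ofReal_cos, ← Complex.ofReal_sin, Real.cos_neg,
    Real.sin_neg]
  push_cast; ring

/-- The tapered transform is `C - iS` with `C`, `S` real linear statistics. This replaces the
complex modulus by squares of jointly Gaussian real variables, where Isserlis' formula applies. -/
theorem norm_fourier_mul_sq {Ω : Type*} {N : ℕ} (x : ℤ → Ω → ℝ) (v : EuclideanSpace ℝ (Fin N)) (f : ℝ)
    (ω : Ω) : ‖fourier (fun n : Fin N => v n * x ((n : ℕ) + 1 : ℕ) ω) f‖ ^ 2 =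
      linearStatistic x (cosTaper v f) ω ^ 2 + linearStatistic x (sinTaper v f) ω ^ 2 := by
  have : fourier (fun n : Fin N => v n * x ((n : ℕ) + 1 : ℕ) ω) f =
      (linearStatistic x (cosTaper v f) ω : ℂ)
        - (linearStatistic x (sinTaper v f) ω : ℂ) * Complex.I := by
    simp only [fourier, linearStatistic, cosTaper, sinTaper, exp_neg_two_pi_mul]
    push_cast
    rw [Finset.sum_mul, ← Finset.sum_sub_distrib]
    exact Finset.sum_congr rfl fun n _ => by ring
  rw [this, ← Complex.normSq_eq_norm_sq, Complex.normSq_apply]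
  simp
  ring

theorem estimate_eq {Ω : Type*} {N K : ℕ} (x : ℤ → Ω → ℝ) (v : Fin K → EuclideanSpace ℝ (Fin N))
    (μ : Fin K → ℝ) (f : ℝ) : estimate x v μ f = fun ω => ∑ k, μ k *
    (linearStatistic x (cosTaper (v k) f) ω ^ 2 + linearStatistic x (sinTaper (v k) f) ω ^ 2) := by
  ext ω
  simp only [estimate, norm_fourier_mul_sq]

theorem memLp_linearStatistic_sq {Ω : Type*} [MeasurableSpace Ω] {P : Measure Ω} {x : ℤ → Ω → ℝ}
    (hx : IsGaussianProcess x P) {N : ℕ} (a : Fin N → ℝ) :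
    MemLp (fun ω => linearStatistic x a ω ^ 2) 2 P :=
  memLp_sq_of_hasGaussianLaw ((isGaussianProcess_linearStatistic hx N).hasGaussianLaw_eval a)

theorem memLp_linearStatistic_sq_add {Ω : Type*} [MeasurableSpace Ω] {P : Measure Ω}
    {x : ℤ → Ω → ℝ} (hx : IsGaussianProcess x P) {N : ℕ} (a b : Fin N → ℝ) :
    MemLp (fun ω => linearStatistic x a ω ^ 2 + linearStatistic x b ω ^ 2) 2 P :=
  (memLp_linearStatistic_sq hx a).add (memLp_linearStatistic_sq hx b)

theorem memLp_estimate {Ω : Type*} [MeasurableSpace Ω] {P : Measure Ω}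
    {x : ℤ → Ω → ℝ} (hx : IsGaussianProcess x P) {N K : ℕ} (v : Fin K → EuclideanSpace ℝ (Fin N))
    (μ : Fin K → ℝ) (f : ℝ) : MemLp (estimate x v μ f) 2 P := by
  rw [estimate_eq]
  exact memLp_finsetSum _ fun k _ => (memLp_linearStatistic_sq_add hx _ _).const_mul _

theorem integral_linearStatistic_sq {Ω : Type*} [MeasurableSpace Ω] {P : Measure Ω}
    [IsProbabilityMeasure P] {x : ℤ → Ω → ℝ} (hx : IsGaussianProcess x P)
    (h0 : ∀ n, ∫ ω, x n ω ∂P = 0) {N : ℕ} (a : Fin N → ℝ) :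
    ∫ ω, linearStatistic x a ω ^ 2 ∂P = cov[linearStatistic x a, linearStatistic x a; P] := by
  have h := ((isGaussianProcess_linearStatistic hx N).hasGaussianLaw_eval a).memLp_two
  rw [covariance_eq_sub h h, integral_linearStatistic hx h0]
  simp [pow_two]

theorem integral_estimate {Ω : Type*} [MeasurableSpace Ω] {P : Measure Ω}
    [IsProbabilityMeasure P] {x : ℤ → Ω → ℝ} (hx : IsGaussianProcess x P)
    (h0 : ∀ n, ∫ ω, x n ω ∂P = 0) {N K : ℕ} (v : Fin K → EuclideanSpace ℝ (Fin N))
    (μ : Fin K → ℝ) (f : ℝ) : ∫ ω, estimate x v μ f ω ∂P = ∑ k, μ k *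
      (cov[linearStatistic x (cosTaper (v k) f), linearStatistic x (cosTaper (v k) f); P] +
        cov[linearStatistic x (sinTaper (v k) f), linearStatistic x (sinTaper (v k) f); P]) := by
  rw [estimate_eq, integral_finsetSum _ fun k _ =>
    ((memLp_linearStatistic_sq_add hx _ _).integrable one_le_two).const_mul _]
  refine Finset.sum_congr rfl fun k _ => ?_
  rw [integral_const_mul, integral_add ((memLp_linearStatistic_sq hx _).integrable one_le_two)
    ((memLp_linearStatistic_sq hx _).integrable one_le_two),
    integral_linearStatistic_sq hx h0, integral_linearStatistic_sq hx h0]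

theorem covariance_linearStatistic_sq {Ω : Type*} [MeasurableSpace Ω] {P : Measure Ω}
    [IsProbabilityMeasure P] {x : ℤ → Ω → ℝ} (hx : IsGaussianProcess x P)
    (h0 : ∀ n, ∫ ω, x n ω ∂P = 0) {N : ℕ} (a b : Fin N → ℝ) :
    cov[fun ω => linearStatistic x a ω ^ 2, fun ω => linearStatistic x b ω ^ 2; P] =
      2 * cov[linearStatistic x a, linearStatistic x b; P] ^ 2 :=
  covariance_sq_sq_of_hasGaussianLaw
    ((isGaussianProcess_linearStatistic hx N).hasGaussianLaw_prodMk)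
    (integral_linearStatistic hx h0 a) (integral_linearStatistic hx h0 b)

theorem variance_estimate {Ω : Type*} [MeasurableSpace Ω] {P : Measure Ω}
    [IsProbabilityMeasure P] {x : ℤ → Ω → ℝ} (hx : IsGaussianProcess x P)
    (h0 : ∀ n, ∫ ω, x n ω ∂P = 0) {N K : ℕ} (v : Fin K → EuclideanSpace ℝ (Fin N))
    (μ : Fin K → ℝ) (f : ℝ) : Var[estimate x v μ f; P] = ∑ k, ∑ l, μ k * μ l * (2 *
      (cov[linearStatistic x (cosTaper (v k) f), linearStatistic x (cosTaper (v l) f); P] ^ 2 +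
        cov[linearStatistic x (cosTaper (v k) f), linearStatistic x (sinTaper (v l) f); P] ^ 2 +
        cov[linearStatistic x (sinTaper (v k) f), linearStatistic x (cosTaper (v l) f); P] ^ 2 +
        cov[linearStatistic x (sinTaper (v k) f), linearStatistic x (sinTaper (v l) f); P] ^ 2)) := by
  have hL := fun a : Fin N → ℝ => memLp_linearStatistic_sq hx a
  have hS := fun a b : Fin N → ℝ => memLp_linearStatistic_sq_add hx a b
  rw [← covariance_self (memLp_estimate hx v μ f).aemeasurable, estimate_eq,
    covariance_fun_sum_fun_sum (fun k => (hS _ _).const_mul _) (fun k => (hS _ _).const_mul _)]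
  refine Finset.sum_congr rfl fun k _ => Finset.sum_congr rfl fun l _ => ?_
  have hadd : ∀ a b c d : Fin N → ℝ,
      cov[fun ω => linearStatistic x a ω ^ 2 + linearStatistic x b ω ^ 2,
        fun ω => linearStatistic x c ω ^ 2 + linearStatistic x d ω ^ 2; P] =
      cov[fun ω => linearStatistic x a ω ^ 2, fun ω => linearStatistic x c ω ^ 2; P] +
      cov[fun ω => linearStatistic x a ω ^ 2, fun ω => linearStatistic x d ω ^ 2; P] +
      (cov[fun ω => linearStatistic x b ω ^ 2, fun ω => linearStatistic x c ω ^ 2; P] +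
      cov[fun ω => linearStatistic x b ω ^ 2, fun ω => linearStatistic x d ω ^ 2; P]) :=
    fun a b c d => (covariance_add_left (hL a) (hL b) (hS c d)).trans
      (congrArg₂ (· + ·) (covariance_add_right (hL a) (hL c) (hL d))
        (covariance_add_right (hL b) (hL c) (hL d)))
  rw [covariance_const_mul_left, covariance_const_mul_right, hadd]
  simp only [covariance_linearStatistic_sq hx h0]
  ring

/-! ### Fourier analysis on the frequency band -/

theorem integral_exp_int (j : ℤ) :
    ∫ h in (-(1 / 2 : ℝ))..(1 / 2), Complex.exp (2 * π * Complex.I * (j : ℂ) * (h : ℂ)) =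
      if j = 0 then 1 else 0 := by
  split_ifs with hj
  · subst hj
    simp only [Int.cast_zero, mul_zero, zero_mul, Complex.exp_zero]
    simp
    norm_num
  · have hc : 2 * π * Complex.I * (j : ℂ) ≠ 0 := by
      simp [Complex.I_ne_zero, Real.pi_ne_zero, hj]
    rw [integral_exp_mul_complex hc]
    have : 2 * π * Complex.I * (j : ℂ) * ((1 / 2 : ℝ) : ℂ) =
        2 * π * Complex.I * (j : ℂ) * ((-(1 / 2) : ℝ) : ℂ) + (j : ℂ) * (2 * π * Complex.I) := by
      push_cast; ring
    rw [this, Complex.exp_add, Complex.exp_int_mul_two_pi_mul_I]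
    simp

theorem integral_period_shift {E : Type*} [NormedAddCommGroup E] [NormedSpace ℝ E] {Φ : ℝ → E}
    (hΦ : Function.Periodic Φ 1) (f : ℝ) :
    ∫ g in (-(1 / 2 : ℝ))..(1 / 2), Φ (g + f) = ∫ g in (-(1 / 2 : ℝ))..(1 / 2), Φ g := by
  rw [intervalIntegral.integral_comp_add_right]
  have := hΦ.intervalIntegral_add_eq (-(1 / 2) + f) (-(1 / 2))
  convert this using 2 <;> ring

theorem integral_period_reflect {E : Type*} [NormedAddCommGroup E] [NormedSpace ℝ E] {Φ : ℝ → E}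
    (hΦ : Function.Periodic Φ 1) (f : ℝ) :
    ∫ g in (-(1 / 2 : ℝ))..(1 / 2), Φ (f - g) = ∫ g in (-(1 / 2 : ℝ))..(1 / 2), Φ g := by
  rw [intervalIntegral.integral_comp_sub_left]
  have := hΦ.intervalIntegral_add_eq (f - 1 / 2) (-(1 / 2))
  convert this using 2 <;> ring

theorem continuous_fourier {N : ℕ} (a : Fin N → ℝ) : Continuous (fourier a) := by
  unfold fourier
  fun_prop

theorem continuous_window {N : ℕ} (v : EuclideanSpace ℝ (Fin N)) : Continuous (window v) :=
  continuous_fourier _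

attribute [fun_prop] continuous_fourier continuous_window

theorem fourier_periodic {N : ℕ} (a : Fin N → ℝ) : Function.Periodic (fourier a) 1 := by
  intro h
  unfold fourier
  refine Finset.sum_congr rfl fun n _ => ?_
  have : -(2 * π * Complex.I * (((n : ℕ) + 1 : ℕ) : ℂ) * ((h + 1 : ℝ) : ℂ)) =
      -(2 * π * Complex.I * (((n : ℕ) + 1 : ℕ) : ℂ) * (h : ℂ)) +
        ((-(((n : ℕ) + 1 : ℕ) : ℤ) : ℤ) : ℂ) * (2 * π * Complex.I) := by
    push_cast; ring
  rw [this, Complex.exp_add, Complex.exp_int_mul_two_pi_mul_I, mul_one]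

theorem window_periodic {N : ℕ} (v : EuclideanSpace ℝ (Fin N)) :
    Function.Periodic (window v) 1 :=
  fourier_periodic _

theorem conj_fourier {N : ℕ} (a : Fin N → ℝ) (h : ℝ) :
    (starRingEnd ℂ) (fourier a h) = fourier a (-h) := by
  unfold fourier
  rw [map_sum]
  refine Finset.sum_congr rfl fun n _ => ?_
  rw [map_mul, Complex.conj_ofReal, ← Complex.exp_conj]
  congr 2
  simp only [map_neg, map_mul, map_ofNat, Complex.conj_I, Complex.conj_ofReal, map_natCast]
  push_cast
  ring

theorem conj_window {N : ℕ} (v : EuclideanSpace ℝ (Fin N)) (h : ℝ) :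
    (starRingEnd ℂ) (window v h) = window v (-h) :=
  conj_fourier _ h

theorem norm_window_neg {N : ℕ} (v : EuclideanSpace ℝ (Fin N)) (h : ℝ) :
    ‖window v (-h)‖ = ‖window v h‖ := by
  rw [← conj_window, RCLike.norm_conj]

/-- Tapers are real, so `V(-h)` is the conjugate of `V(h)`. Products are kept in the form `V(h)
W(-h)`, which avoids conjugation inside the spectral integrals. -/
theorem window_mul_window_neg {N : ℕ} (v : EuclideanSpace ℝ (Fin N)) (h : ℝ) :
    window v h * window v (-h) = ((‖window v h‖ ^ 2 : ℝ) : ℂ) := by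
  rw [← conj_window, Complex.mul_conj, Complex.normSq_eq_norm_sq]

theorem fourier_mul_fourier_neg {N : ℕ} (a b : Fin N → ℝ) (g : ℝ) :
    fourier a (-g) * fourier b g = ∑ n : Fin N, ∑ m : Fin N, (a n : ℂ) * (b m : ℂ) *
      Complex.exp (2 * π * Complex.I *
        (((((n : ℕ) + 1 : ℕ) : ℤ) - (((m : ℕ) + 1 : ℕ) : ℤ) : ℤ) : ℂ) * (g : ℂ)) := by
  unfold fourier
  rw [Finset.sum_mul_sum]
  refine Finset.sum_congr rfl fun n _ => Finset.sum_congr rfl fun m _ => ?_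
  rw [mul_mul_mul_comm, ← Complex.exp_add]
  congr 2
  push_cast
  ring

theorem integral_fourier_mul_fourier_neg {N : ℕ} (a b : Fin N → ℝ) :
    ∫ g in (-(1 / 2 : ℝ))..(1 / 2), fourier a (-g) * fourier b g =
      ((∑ n, a n * b n : ℝ) : ℂ) := by
  simp only [fourier_mul_fourier_neg]
  rw [intervalIntegral.integral_finsetSum fun n _ =>
    Continuous.intervalIntegrable (by fun_prop) _ _]
  rw [Complex.ofReal_sum]
  refine Finset.sum_congr rfl fun n _ => ?_
  rw [intervalIntegral.integral_finsetSum fun m _ =>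
    Continuous.intervalIntegrable (by fun_prop) _ _]
  simp only [intervalIntegral.integral_const_mul, integral_exp_int]
  rw [Finset.sum_eq_single n]
  · simp
  · intro m _ hm
    rw [if_neg, mul_zero]
    intro h
    exact hm (Fin.ext (by omega))
  · simp

/-- Parseval's identity for windows. -/
theorem integral_window_mul_window_neg {N : ℕ} (v w : EuclideanSpace ℝ (Fin N)) :
    ∫ g in (-(1 / 2 : ℝ))..(1 / 2), window v g * window w (-g) = ((inner ℝ v w : ℝ) : ℂ) := by
  have h := integral_fourier_mul_fourier_neg (fun n => w n) (fun n => v n)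
  rw [PiLp.inner_apply]
  simp only [RCLike.inner_apply, conj_trivial]
  rw [← h]
  exact intervalIntegral.integral_congr fun g _ => mul_comm _ _

/-! ### Covariances of tapered transforms as spectral integrals -/

/-- Expand both sides bilinearly; each pair of times gives one Fourier coefficient of `S`. The
function `T` is a continuous extension of `S` from the band, so that every integrand is continuous
on the whole line. -/
theorem covariance_linearStatistic_eq_integral {Ω : Type*} [MeasurableSpace Ω] {P : Measure Ω}
    [IsProbabilityMeasure P] {x : ℤ → Ω → ℝ} {S T : ℝ → ℝ} (hx : IsStationaryGaussian P x S)
    (hT : Continuous T) (hTS : ∀ g ∈ Icc (-(1 / 2 : ℝ)) (1 / 2), T g = S g) {N : ℕ}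
    (a b : Fin N → ℝ) :
    ((cov[linearStatistic x a, linearStatistic x b; P] : ℝ) : ℂ) =
      ∫ g in (-(1 / 2 : ℝ))..(1 / 2), (T g : ℂ) * (fourier a (-g) * fourier b g) := by
  rw [covariance_linearStatistic hx.gaussian]
  simp only [fourier_mul_fourier_neg, Finset.mul_sum]
  rw [intervalIntegral.integral_finsetSum fun n _ =>
    Continuous.intervalIntegrable (by fun_prop) _ _]
  push_cast
  refine Finset.sum_congr rfl fun n _ => ?_
  rw [intervalIntegral.integral_finsetSum fun m _ =>
    Continuous.intervalIntegrable (by fun_prop) _ _]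
  refine Finset.sum_congr rfl fun m _ => ?_
  have h := hx.covariance_eq ((n : ℕ) + 1 : ℕ) ((m : ℕ) + 1 : ℕ)
  push_cast at h
  rw [h, ← intervalIntegral.integral_const_mul]
  refine intervalIntegral.integral_congr fun g hg => ?_
  rw [uIcc_of_le (by norm_num)] at hg
  simp only [hTS g hg]
  ring

theorem fourier_cosTaper_sub {N : ℕ} (v : EuclideanSpace ℝ (Fin N)) (f h : ℝ) :
    fourier (cosTaper v f) h - Complex.I * fourier (sinTaper v f) h = window v (f + h) := by
  unfold window fourier cosTaper sinTaper
  rw [Finset.mul_sum, ← Finset.sum_sub_distrib]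
  refine Finset.sum_congr rfl fun n _ => ?_
  have : -(2 * π * Complex.I * (((n : ℕ) + 1 : ℕ) : ℂ) * ((f + h : ℝ) : ℂ)) =
      -(2 * π * Complex.I * (((n : ℕ) + 1 : ℕ) : ℂ) * (f : ℂ)) +
      -(2 * π * Complex.I * (((n : ℕ) + 1 : ℕ) : ℂ) * (h : ℂ)) := by push_cast; ring
  rw [this, Complex.exp_add, exp_neg_two_pi_mul _ f]
  push_cast
  ring

theorem fourier_cosTaper_add {N : ℕ} (v : EuclideanSpace ℝ (Fin N)) (f h : ℝ) :
    fourier (cosTaper v f) h + Complex.I * fourier (sinTaper v f) h = window v (h - f) := by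
  have := congrArg (starRingEnd ℂ) (fourier_cosTaper_sub v f (-h))
  rw [map_sub, map_mul, conj_fourier, conj_fourier, conj_window, Complex.conj_I, neg_neg] at this
  rw [show h - f = -(f + -h) by ring, ← this]
  ring

/-- The covariance `E[Jₖ(f) conj Jₗ(f)]` of two tapered Fourier transforms, as a spectral
integral. -/
def spectralForm {N : ℕ} (T : ℝ → ℝ) (v w : EuclideanSpace ℝ (Fin N)) (f : ℝ) : ℂ :=
  ∫ g in (-(1 / 2 : ℝ))..(1 / 2), (T g : ℂ) * (window v (f - g) * window w (g - f))

/-- The pseudo-covariance `E[Jₖ(f) Jₗ(f)]` of two tapered Fourier transforms, as a spectral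
integral. -/
def pseudoSpectralForm {N : ℕ} (T : ℝ → ℝ) (v w : EuclideanSpace ℝ (Fin N)) (f : ℝ) : ℂ :=
  ∫ g in (-(1 / 2 : ℝ))..(1 / 2), (T g : ℂ) * (window v (f - g) * window w (f + g))

/-- This is `(C_v - iS_v)(C_w + iS_w)` in expectation; the matching combination of modulated tapers
transforms into the shifted windows. -/
theorem spectralForm_eq {Ω : Type*} [MeasurableSpace Ω] {P : Measure Ω}
    [IsProbabilityMeasure P] {x : ℤ → Ω → ℝ} {S T : ℝ → ℝ} (hx : IsStationaryGaussian P x S)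
    (hT : Continuous T) (hTS : ∀ g ∈ Icc (-(1 / 2 : ℝ)) (1 / 2), T g = S g) {N : ℕ}
    (v w : EuclideanSpace ℝ (Fin N)) (f : ℝ) :
    spectralForm T v w f =
      ((cov[linearStatistic x (cosTaper v f), linearStatistic x (cosTaper w f); P] +
        cov[linearStatistic x (sinTaper v f), linearStatistic x (sinTaper w f); P] : ℝ) : ℂ) +
      ((cov[linearStatistic x (cosTaper v f), linearStatistic x (sinTaper w f); P] -
        cov[linearStatistic x (sinTaper v f), linearStatistic x (cosTaper w f); P] : ℝ) : ℂ) *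
          Complex.I := by
  have hc := fun a b : Fin N → ℝ => covariance_linearStatistic_eq_integral hx hT hTS a b
  have hi : ∀ a b : Fin N → ℝ, IntervalIntegrable
      (fun g : ℝ => (T g : ℂ) * (fourier a (-g) * fourier b g)) volume (-(1 / 2)) (1 / 2) :=
    fun a b => Continuous.intervalIntegrable (by fun_prop) _ _
  push_cast
  rw [hc, hc, hc, hc, ← intervalIntegral.integral_add (hi _ _) (hi _ _),
    ← intervalIntegral.integral_sub (hi _ _) (hi _ _), ← intervalIntegral.integral_mul_const,
    ← intervalIntegral.integral_add ((hi _ _).add (hi _ _)) (((hi _ _).sub (hi _ _)).mul_const _)]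
  refine intervalIntegral.integral_congr fun g _ => ?_
  simp only [sub_eq_add_neg f g, ← fourier_cosTaper_sub, ← fourier_cosTaper_add]
  linear_combination (-(T g : ℂ) * fourier (sinTaper v f) (-g) * fourier (sinTaper w f) g) *
    Complex.I_mul_I

theorem pseudoSpectralForm_eq {Ω : Type*} [MeasurableSpace Ω] {P : Measure Ω}
    [IsProbabilityMeasure P] {x : ℤ → Ω → ℝ} {S T : ℝ → ℝ} (hx : IsStationaryGaussian P x S)
    (hT : Continuous T) (hTS : ∀ g ∈ Icc (-(1 / 2 : ℝ)) (1 / 2), T g = S g) {N : ℕ}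
    (v w : EuclideanSpace ℝ (Fin N)) (f : ℝ) :
    pseudoSpectralForm T v w f =
      ((cov[linearStatistic x (cosTaper v f), linearStatistic x (cosTaper w f); P] -
        cov[linearStatistic x (sinTaper v f), linearStatistic x (sinTaper w f); P] : ℝ) : ℂ) +
      ((-(cov[linearStatistic x (cosTaper v f), linearStatistic x (sinTaper w f); P] +
        cov[linearStatistic x (sinTaper v f), linearStatistic x (cosTaper w f); P]) : ℝ) : ℂ) *
          Complex.I := by
  have hc := fun a b : Fin N → ℝ => covariance_linearStatistic_eq_integral hx hT hTS a b
  have hi : ∀ a b : Fin N → ℝ, IntervalIntegrable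
      (fun g : ℝ => (T g : ℂ) * (fourier a (-g) * fourier b g)) volume (-(1 / 2)) (1 / 2) :=
    fun a b => Continuous.intervalIntegrable (by fun_prop) _ _
  push_cast
  rw [hc, hc, hc, hc, ← intervalIntegral.integral_add (hi _ _) (hi _ _),
    ← intervalIntegral.integral_sub (hi _ _) (hi _ _), ← intervalIntegral.integral_neg,
    ← intervalIntegral.integral_mul_const,
    ← intervalIntegral.integral_add ((hi _ _).sub (hi _ _))
      (Continuous.intervalIntegrable (by fun_prop) _ _)]
  refine intervalIntegral.integral_congr fun g _ => ?_
  simp only [sub_eq_add_neg f g, ← fourier_cosTaper_sub]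
  linear_combination ((T g : ℂ) * fourier (sinTaper v f) (-g) * fourier (sinTaper w f) g) *
    Complex.I_mul_I

theorem integral_estimate_eq_spectralForm {Ω : Type*} [MeasurableSpace Ω] {P : Measure Ω}
    [IsProbabilityMeasure P] {x : ℤ → Ω → ℝ} {S T : ℝ → ℝ} (hx : IsStationaryGaussian P x S)
    (hT : Continuous T) (hTS : ∀ g ∈ Icc (-(1 / 2 : ℝ)) (1 / 2), T g = S g) {N K : ℕ}
    (v : Fin K → EuclideanSpace ℝ (Fin N)) (μ : Fin K → ℝ) (f : ℝ) :
    ∫ ω, estimate x v μ f ω ∂P = ∑ k, μ k * (spectralForm T (v k) (v k) f).re := by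
  rw [integral_estimate hx.gaussian hx.mean_zero]
  refine Finset.sum_congr rfl fun k _ => ?_
  rw [spectralForm_eq hx hT hTS]
  simp

/-- With the four real covariances called `a, b, c, d`, the parallelogram law `(a+d)² + (b-c)² +
(a-d)² + (b+c)² = 2(a²+b²+c²+d²)` absorbs the factor two from Isserlis. -/
theorem variance_estimate_eq_spectralForm {Ω : Type*} [MeasurableSpace Ω] {P : Measure Ω}
    [IsProbabilityMeasure P] {x : ℤ → Ω → ℝ} {S T : ℝ → ℝ} (hx : IsStationaryGaussian P x S)
    (hT : Continuous T) (hTS : ∀ g ∈ Icc (-(1 / 2 : ℝ)) (1 / 2), T g = S g) {N K : ℕ}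
    (v : Fin K → EuclideanSpace ℝ (Fin N)) (μ : Fin K → ℝ) (f : ℝ) :
    Var[estimate x v μ f; P] = ∑ k, ∑ l, μ k * μ l *
      (‖spectralForm T (v k) (v l) f‖ ^ 2 + ‖pseudoSpectralForm T (v k) (v l) f‖ ^ 2) := by
  rw [variance_estimate hx.gaussian hx.mean_zero]
  refine Finset.sum_congr rfl fun k _ => Finset.sum_congr rfl fun l _ => ?_
  rw [spectralForm_eq hx hT hTS, pseudoSpectralForm_eq hx hT hTS, ← Complex.normSq_eq_norm_sq,
    ← Complex.normSq_eq_norm_sq, Complex.normSq_add_mul_I, Complex.normSq_add_mul_I]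
  ring

/-! ### Bessel's inequality -/

/-- Bessel's inequality for continuous functions on the frequency band. -/
theorem sum_norm_integral_mul_conj_le {ι : Type*} [Fintype ι] [DecidableEq ι] {e : ι → ℝ → ℂ}
    (he : ∀ i, Continuous (e i))
    (horth : ∀ i j, ∫ g in (-(1 / 2 : ℝ))..(1 / 2), (starRingEnd ℂ) (e i g) * e j g =
      if i = j then 1 else 0)
    {G : ℝ → ℂ} (hG : Continuous G) :
    ∑ i, ‖∫ g in (-(1 / 2 : ℝ))..(1 / 2), G g * (starRingEnd ℂ) (e i g)‖ ^ 2 ≤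
      ∫ g in (-(1 / 2 : ℝ))..(1 / 2), ‖G g‖ ^ 2 := by
  have hle : (-(1 / 2 : ℝ)) ≤ 1 / 2 := by norm_num
  set ν : Measure ℝ := volume.restrict (Ioc (-(1 / 2)) (1 / 2)) with hν
  have hmem : ∀ F : ℝ → ℂ, Continuous F → MemLp F 2 ν := fun F hF => by
    rw [memLp_two_iff_integrable_sq_norm hF.aestronglyMeasurable]
    exact Continuous.integrableOn_Ioc (by fun_prop)
  have hin : ∀ (F H : ℝ → ℂ) (hF : Continuous F) (hH : Continuous H),
      inner ℂ ((hmem F hF).toLp F) ((hmem H hH).toLp H) =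
        ∫ g in (-(1 / 2 : ℝ))..(1 / 2), (starRingEnd ℂ) (F g) * H g := fun F H hF hH => by
    rw [L2.inner_def, intervalIntegral.integral_of_le hle]
    refine integral_congr_ae ?_
    filter_upwards [(hmem F hF).coeFn_toLp, (hmem H hH).coeFn_toLp] with g h1 h2
    rw [h1, h2, RCLike.inner_apply, mul_comm]
  have ho : Orthonormal ℂ fun i => (hmem (e i) (he i)).toLp (e i) := by
    rw [orthonormal_iff_ite]
    intro i j
    rw [hin _ _ (he i) (he j), horth]
  have hB := ho.sum_inner_products_le ((hmem G hG).toLp G) (s := Finset.univ)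
  have hn : ‖(hmem G hG).toLp G‖ ^ 2 = ∫ g in (-(1 / 2 : ℝ))..(1 / 2), ‖G g‖ ^ 2 := by
    have h1 := hin G G hG hG
    rw [inner_self_eq_norm_sq_to_K] at h1
    have h2 : ∀ g, (starRingEnd ℂ) (G g) * G g = ((‖G g‖ ^ 2 : ℝ) : ℂ) := fun g => by
      rw [mul_comm, Complex.mul_conj, Complex.normSq_eq_norm_sq]
    simp only [h2] at h1
    rw [intervalIntegral.integral_ofReal] at h1
    apply Complex.ofReal_injective
    rw [← h1]
    push_cast
    rfl
  rw [hn] at hB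
  refine le_trans (le_of_eq (Finset.sum_congr rfl fun i _ => ?_)) hB
  rw [hin _ _ (he i) hG]
  congr 2
  exact intervalIntegral.integral_congr fun g _ => mul_comm _ _

/-! ### Distance modulo one and periodic forms of the local bias -/

/-- The distance of a real number to the nearest integer. -/
def circleDist (h : ℝ) : ℝ := ‖(h : UnitAddCircle)‖

theorem continuous_circleDist : Continuous circleDist :=
  continuous_norm.comp (AddCircle.continuous_mk' 1)

attribute [fun_prop] continuous_circleDist

theorem circleDist_nonneg (h : ℝ) : 0 ≤ circleDist h := norm_nonneg _

theorem circleDist_periodic : Function.Periodic circleDist 1 := fun h => by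
  simp [circleDist]

theorem circleDist_neg (h : ℝ) : circleDist (-h) = circleDist h := by
  simp [circleDist]

theorem circleDist_of_abs_le {h : ℝ} (hh : |h| ≤ 1 / 2) : circleDist h = |h| :=
  (AddCircle.norm_coe_eq_abs_iff 1 one_ne_zero).2 (by simpa using hh)

theorem circleDist_add_le (h g : ℝ) : circleDist (h + g) ≤ circleDist h + circleDist g := by
  unfold circleDist
  rw [AddCircle.coe_add]
  exact norm_add_le _ _

theorem circleDist_add_int (h : ℝ) (n : ℤ) : circleDist (h + n) = circleDist h := by
  simpa using circleDist_periodic.int_mul n h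

/-- Twice a frequency away from `0` and `±1/2` is away from the integers. -/
theorem le_circleDist_two_mul {η f : ℝ} (h1 : η ≤ |f|) (h2 : |f| ≤ 1 / 2 - η) :
    2 * η ≤ circleDist (2 * f) := by
  have key : ∀ f : ℝ, 0 ≤ f → η ≤ f → f ≤ 1 / 2 - η → 2 * η ≤ circleDist (2 * f) := by
    intro f h0 h1 h2
    rcases le_total f (1 / 4) with h | h
    · rw [circleDist_of_abs_le (by rw [abs_of_nonneg] <;> linarith), abs_of_nonneg] <;> linarith
    · have := circleDist_add_int (2 * f) (-1)
      rw [← this]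
      push_cast
      rcases le_total f (1 / 2) with h3 | h3
      · rw [circleDist_of_abs_le (by rw [abs_of_nonpos] <;> linarith), abs_of_nonpos] <;> linarith
      · exact le_trans (by linarith) (circleDist_nonneg _)
  rcases abs_cases f with ⟨h, h'⟩ | ⟨h, h'⟩
  · exact key f h' (h ▸ h1) (h ▸ h2)
  · have := key (-f) (by linarith) (h ▸ h1) (h ▸ h2)
    rwa [mul_neg, circleDist_neg] at this

/-- The distance in frequency modulo one, for a frequency at distance `η` from the band edges. -/
theorem circleDist_sub_cases {η f g : ℝ} (hf : |f| ≤ 1 / 2 - η)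
    (hg : g ∈ Icc (-(1 / 2 : ℝ)) (1 / 2)) :
    circleDist (f - g) = |f - g| ∨ η ≤ circleDist (f - g) := by
  rcases le_or_gt |f - g| (1 / 2) with h | h
  · exact Or.inl (circleDist_of_abs_le h)
  right
  obtain ⟨hg1, hg2⟩ := hg
  obtain ⟨hf1, hf2⟩ := abs_le.1 hf
  rcases lt_abs.1 h with h | h
  · have := circleDist_add_int (f - g) (-1)
    rw [← this]
    push_cast
    rcases le_total 0 η with h0 | h0
    · rw [circleDist_of_abs_le (by rw [abs_of_nonpos] <;> linarith), abs_of_nonpos] <;> linarith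
    · exact h0.trans (circleDist_nonneg _)
  · have := circleDist_add_int (f - g) 1
    rw [← this]
    push_cast
    rcases le_total 0 η with h0 | h0
    · rw [circleDist_of_abs_le (by rw [abs_of_nonneg] <;> linarith), abs_of_nonneg] <;> linarith
    · exact h0.trans (circleDist_nonneg _)

theorem integral_Icc_eq_intervalIntegral {E : Type*} [NormedAddCommGroup E] [NormedSpace ℝ E]
    (F : ℝ → E) : ∫ h in Icc (-(1 / 2 : ℝ)) (1 / 2), F h = ∫ h in (-(1 / 2 : ℝ))..(1 / 2), F h := by
  rw [integral_Icc_eq_integral_Ioc, intervalIntegral.integral_of_le (by norm_num)]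

theorem mem_Icc_of_mem_uIcc_half {g : ℝ} (hg : g ∈ uIcc (-(1 / 2 : ℝ)) (1 / 2)) :
    g ∈ Icc (-(1 / 2 : ℝ)) (1 / 2) := by
  rwa [uIcc_of_le (by norm_num)] at hg

/-- Replacing `|h|` by the circular distance makes the integrand periodic, so the local bias may be
recentred at any frequency. -/
theorem localBias_eq {N : ℕ} (v : EuclideanSpace ℝ (Fin N)) :
    localBias v = ∫ h in (-(1 / 2 : ℝ))..(1 / 2), circleDist h ^ 2 * ‖window v h‖ ^ 2 := by
  rw [localBias, integral_Icc_eq_intervalIntegral]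
  refine intervalIntegral.integral_congr fun h hh => ?_
  have := mem_Icc_of_mem_uIcc_half hh
  simp only [circleDist_of_abs_le (abs_le.2 this), sq_abs]

theorem localBias_nonneg {N : ℕ} (v : EuclideanSpace ℝ (Fin N)) : 0 ≤ localBias v :=
  integral_nonneg fun _ => by positivity

theorem localBias_eq_reflect {N : ℕ} (v : EuclideanSpace ℝ (Fin N)) (f : ℝ) :
    localBias v = ∫ g in (-(1 / 2 : ℝ))..(1 / 2),
      circleDist (f - g) ^ 2 * ‖window v (f - g)‖ ^ 2 := by
  rw [localBias_eq, ← integral_period_reflect (f := f)]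
  intro h
  simp only [circleDist_periodic h, window_periodic v h]

theorem localBias_eq_shift {N : ℕ} (v : EuclideanSpace ℝ (Fin N)) (f : ℝ) :
    localBias v = ∫ g in (-(1 / 2 : ℝ))..(1 / 2),
      circleDist (f + g) ^ 2 * ‖window v (f + g)‖ ^ 2 := by
  rw [localBias_eq, ← integral_period_shift (f := f)]
  · simp only [add_comm]
  intro h
  simp only [circleDist_periodic h, window_periodic v h]

theorem localBiasBeyond_eq_reflect {N : ℕ} (v : EuclideanSpace ℝ (Fin N)) (δ f : ℝ) :
    localBiasBeyond v δ = ∫ g in (-(1 / 2 : ℝ))..(1 / 2),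
      {g | δ < circleDist (f - g)}.indicator
        (fun g => circleDist (f - g) ^ 2 * ‖window v (f - g)‖ ^ 2) g := by
  have h1 := integral_period_reflect (f := f) (Φ := fun h => {h | δ < circleDist h}.indicator
        (fun h => circleDist h ^ 2 * ‖window v h‖ ^ 2) h) (by
    intro h
    simp only [Set.indicator, mem_ofPred_eq, circleDist_periodic h, window_periodic v h])
  simp only [Set.indicator, mem_ofPred_eq] at h1 ⊢
  rw [h1, localBiasBeyond, sdiff_eq, ← setIntegral_indicator measurableSet_Icc.compl,
    integral_Icc_eq_intervalIntegral]
  refine intervalIntegral.integral_congr fun h hh => ?_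
  have := mem_Icc_of_mem_uIcc_half hh
  simp only [circleDist_of_abs_le (abs_le.2 this), sq_abs, Set.indicator, mem_compl_iff, mem_Icc,
    ← abs_le, not_le]

/-! ### Schur test and window energies -/

/-- Schur test by the weighted inequality `|xy| ≤ t x²/2 + y²/(2t)`, summed along rows and columns.
No factor `K` appears, and the free `t` lets a small row bound compensate a merely bounded column
bound, or the reverse. -/
theorem sum_abs_mul_abs_mul_le {K : ℕ} (μ : Fin K → ℝ) {c : Fin K → Fin K → ℝ}
    (hc : ∀ k l, 0 ≤ c k l) {a b t : ℝ} (ht : 0 < t) (ha : ∀ k, ∑ l, c k l ≤ a)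
    (hb : ∀ l, ∑ k, c k l ≤ b) :
    ∑ k, ∑ l, |μ k * μ l| * c k l ≤ (t * a + b / t) / 2 * ∑ k, μ k ^ 2 := by
  have h1 : ∀ k l, |μ k * μ l| * c k l ≤ t / 2 * (μ k ^ 2 * c k l) + 1 / (2 * t) * (μ l ^ 2 * c k l) := by
    intro k l
    have : |μ k * μ l| ≤ t / 2 * μ k ^ 2 + 1 / (2 * t) * μ l ^ 2 := by
      rw [abs_mul, ← sq_abs (μ k), ← sq_abs (μ l)]
      have : t / 2 * |μ k| ^ 2 + 1 / (2 * t) * |μ l| ^ 2 - |μ k| * |μ l| =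
        1 / (2 * t) * (t * |μ k| - |μ l|) ^ 2 := by field_simp; ring
      have h2 : 0 ≤ 1 / (2 * t) * (t * |μ k| - |μ l|) ^ 2 := by positivity
      linarith
    calc _ ≤ _ := mul_le_mul_of_nonneg_right this (hc k l)
      _ = _ := by ring
  calc _ ≤ ∑ k, ∑ l, (t / 2 * (μ k ^ 2 * c k l) + 1 / (2 * t) * (μ l ^ 2 * c k l)) :=
        Finset.sum_le_sum fun k _ => Finset.sum_le_sum fun l _ => h1 k l
    _ = t / 2 * ∑ k, μ k ^ 2 * ∑ l, c k l + 1 / (2 * t) * ∑ l, μ l ^ 2 * ∑ k, c k l := by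
        simp only [Finset.sum_add_distrib]
        congr 1
        · simp only [Finset.mul_sum]
        · rw [Finset.sum_comm]; simp only [Finset.mul_sum]
    _ ≤ t / 2 * ∑ k, μ k ^ 2 * a + 1 / (2 * t) * ∑ l, μ l ^ 2 * b := by
        gcongr with k _ l _
        · exact ha k
        · exact hb l
    _ = _ := by rw [← Finset.sum_mul, ← Finset.sum_mul]; field_simp

section Bessel

variable {N K : ℕ} {v : Fin K → EuclideanSpace ℝ (Fin N)}

theorem integral_conj_window_mul_window (hv : Orthonormal ℝ v) (i j : Fin K) :
    ∫ g in (-(1 / 2 : ℝ))..(1 / 2), (starRingEnd ℂ) (window (v i) g) * window (v j) g =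
      if i = j then 1 else 0 := by
  simp only [conj_window, mul_comm (window (v i) _)]
  rw [integral_window_mul_window_neg, orthonormal_iff_ite.1 hv]
  rcases eq_or_ne i j with h | h
  · simp [h]
  · simp [h, h.symm]

theorem integral_conj_window_mul_window_periodic (v w : EuclideanSpace ℝ (Fin N)) :
    Function.Periodic (fun g => (starRingEnd ℂ) (window v g) * window w g) 1 := fun g => by
  simp only [window_periodic v g, window_periodic w g]

/-- By periodicity, shifting or reflecting the windows preserves their orthonormality on the band,
so Bessel's inequality applies to them. -/
theorem sum_norm_integral_mul_window_shift_le (hv : Orthonormal ℝ v) {G : ℝ → ℂ}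
    (hG : Continuous G) (f : ℝ) :
    ∑ i, ‖∫ g in (-(1 / 2 : ℝ))..(1 / 2), G g * window (v i) (g + f)‖ ^ 2 ≤
      ∫ g in (-(1 / 2 : ℝ))..(1 / 2), ‖G g‖ ^ 2 := by
  have := sum_norm_integral_mul_conj_le (e := fun i g => window (v i) (-f - g))
    (fun i => by fun_prop) (fun i j => by
      rw [integral_period_reflect (integral_conj_window_mul_window_periodic (v i) (v j)),
        integral_conj_window_mul_window hv]) hG
  simpa [conj_window] using this

theorem sum_norm_integral_mul_window_reflect_le (hv : Orthonormal ℝ v) {G : ℝ → ℂ}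
    (hG : Continuous G) (f : ℝ) :
    ∑ i, ‖∫ g in (-(1 / 2 : ℝ))..(1 / 2), G g * window (v i) (f - g)‖ ^ 2 ≤
      ∫ g in (-(1 / 2 : ℝ))..(1 / 2), ‖G g‖ ^ 2 := by
  have := sum_norm_integral_mul_conj_le (e := fun i g => window (v i) (g + -f))
    (fun i => by fun_prop) (fun i j => by
      rw [integral_period_shift (integral_conj_window_mul_window_periodic (v i) (v j)),
        integral_conj_window_mul_window hv]) hG
  simpa [conj_window, sub_eq_add_neg] using this

/-- For fixed `k` the entries are the coefficients of the single function `W · V_k(f - ·)` in an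
orthonormal family of shifted windows. -/
theorem sum_norm_spectralForm_row_le (hv : Orthonormal ℝ v) {W : ℝ → ℝ} (hW : Continuous W)
    (f : ℝ) (k : Fin K) : ∑ l, ‖spectralForm W (v k) (v l) f‖ ^ 2 ≤
      ∫ g in (-(1 / 2 : ℝ))..(1 / 2), W g ^ 2 * ‖window (v k) (f - g)‖ ^ 2 := by
  have := sum_norm_integral_mul_window_shift_le hv (G := fun g => W g * window (v k) (f - g))
    (by fun_prop) (-f)
  simpa [spectralForm, mul_assoc, mul_pow, sub_eq_add_neg] using this

theorem sum_norm_spectralForm_col_le (hv : Orthonormal ℝ v) {W : ℝ → ℝ} (hW : Continuous W)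
    (f : ℝ) (l : Fin K) : ∑ k, ‖spectralForm W (v k) (v l) f‖ ^ 2 ≤
      ∫ g in (-(1 / 2 : ℝ))..(1 / 2), W g ^ 2 * ‖window (v l) (f - g)‖ ^ 2 := by
  have := sum_norm_integral_mul_window_reflect_le hv (G := fun g => W g * window (v l) (g - f))
    (by fun_prop) f
  have h2 : ∀ g, ‖window (v l) (g - f)‖ = ‖window (v l) (f - g)‖ := fun g => by
    rw [← norm_window_neg, neg_sub]
  simp only [norm_mul, h2, mul_pow] at this
  simpa [spectralForm, mul_assoc, mul_comm, mul_left_comm] using this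

theorem sum_norm_pseudoSpectralForm_row_le (hv : Orthonormal ℝ v) {W : ℝ → ℝ} (hW : Continuous W)
    (f : ℝ) (k : Fin K) : ∑ l, ‖pseudoSpectralForm W (v k) (v l) f‖ ^ 2 ≤
      ∫ g in (-(1 / 2 : ℝ))..(1 / 2), W g ^ 2 * ‖window (v k) (f - g)‖ ^ 2 := by
  have := sum_norm_integral_mul_window_shift_le hv (G := fun g => W g * window (v k) (f - g))
    (by fun_prop) f
  simpa [pseudoSpectralForm, mul_assoc, mul_pow, add_comm f] using this

theorem sum_norm_pseudoSpectralForm_col_le (hv : Orthonormal ℝ v) {W : ℝ → ℝ} (hW : Continuous W)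
    (f : ℝ) (l : Fin K) : ∑ k, ‖pseudoSpectralForm W (v k) (v l) f‖ ^ 2 ≤
      ∫ g in (-(1 / 2 : ℝ))..(1 / 2), W g ^ 2 * ‖window (v l) (f + g)‖ ^ 2 := by
  have := sum_norm_integral_mul_window_reflect_le hv (G := fun g => W g * window (v l) (f + g))
    (by fun_prop) f
  simp only [norm_mul, mul_pow] at this
  simpa [pseudoSpectralForm, mul_assoc, mul_comm, mul_left_comm] using this

end Bessel

/-- Weighted energies of a taper are controlled by a bound of the weight by `c · circleDist`. -/
theorem integral_sq_mul_window_reflect_le {N : ℕ} (v : EuclideanSpace ℝ (Fin N)) {W : ℝ → ℝ}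
    (hW : Continuous W) {c f : ℝ}
    (hc : ∀ g ∈ Icc (-(1 / 2 : ℝ)) (1 / 2), |W g| ≤ c * circleDist (f - g)) :
    ∫ g in (-(1 / 2 : ℝ))..(1 / 2), W g ^ 2 * ‖window v (f - g)‖ ^ 2 ≤ c ^ 2 * localBias v := by
  rw [localBias_eq_reflect v f, ← intervalIntegral.integral_const_mul]
  refine intervalIntegral.integral_mono_on (by norm_num)
    (Continuous.intervalIntegrable (by fun_prop) _ _)
    (Continuous.intervalIntegrable (by fun_prop) _ _) fun g hg => ?_
  have := pow_le_pow_left₀ (abs_nonneg _) (hc g hg) 2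
  rw [sq_abs, mul_pow] at this
  rw [← mul_assoc]
  gcongr

theorem integral_sq_mul_window_shift_le {N : ℕ} (v : EuclideanSpace ℝ (Fin N)) {W : ℝ → ℝ}
    (hW : Continuous W) {c f : ℝ}
    (hc : ∀ g ∈ Icc (-(1 / 2 : ℝ)) (1 / 2), |W g| ≤ c * circleDist (f + g)) :
    ∫ g in (-(1 / 2 : ℝ))..(1 / 2), W g ^ 2 * ‖window v (f + g)‖ ^ 2 ≤ c ^ 2 * localBias v := by
  rw [localBias_eq_shift v f, ← intervalIntegral.integral_const_mul]
  refine intervalIntegral.integral_mono_on (by norm_num)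
    (Continuous.intervalIntegrable (by fun_prop) _ _)
    (Continuous.intervalIntegrable (by fun_prop) _ _) fun g hg => ?_
  have := pow_le_pow_left₀ (abs_nonneg _) (hc g hg) 2
  rw [sq_abs, mul_pow] at this
  rw [← mul_assoc]
  gcongr

theorem integral_norm_window_sq {N : ℕ} (v : EuclideanSpace ℝ (Fin N)) :
    ∫ g in (-(1 / 2 : ℝ))..(1 / 2), ‖window v g‖ ^ 2 = inner ℝ v v := by
  have := integral_window_mul_window_neg v v
  simp only [window_mul_window_neg] at this
  rw [intervalIntegral.integral_ofReal] at this
  exact Complex.ofReal_injective this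

theorem norm_window_sq_periodic {N : ℕ} (v : EuclideanSpace ℝ (Fin N)) :
    Function.Periodic (fun g => ‖window v g‖ ^ 2) 1 := fun g => by
  simp only [window_periodic v g]

theorem integral_sq_mul_window_reflect_le_of_bounded {N : ℕ} {v : EuclideanSpace ℝ (Fin N)}
    (hv : ‖v‖ = 1) {W : ℝ → ℝ} (hW : Continuous W) {c : ℝ}
    (hc : ∀ g ∈ Icc (-(1 / 2 : ℝ)) (1 / 2), |W g| ≤ c) (f : ℝ) :
    ∫ g in (-(1 / 2 : ℝ))..(1 / 2), W g ^ 2 * ‖window v (f - g)‖ ^ 2 ≤ c ^ 2 := by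
  have h1 : ∫ g in (-(1 / 2 : ℝ))..(1 / 2), c ^ 2 * ‖window v (f - g)‖ ^ 2 = c ^ 2 := by
    rw [intervalIntegral.integral_const_mul,
      integral_period_reflect (norm_window_sq_periodic v) f, integral_norm_window_sq,
      real_inner_self_eq_norm_sq, hv]
    ring
  rw [← h1]
  refine intervalIntegral.integral_mono_on (by norm_num)
    (Continuous.intervalIntegrable (by fun_prop) _ _)
    (Continuous.intervalIntegrable (by fun_prop) _ _) fun g hg => ?_
  have := pow_le_pow_left₀ (abs_nonneg _) (hc g hg) 2
  rw [sq_abs] at this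
  gcongr

theorem integral_sq_mul_window_shift_le_of_bounded {N : ℕ} {v : EuclideanSpace ℝ (Fin N)}
    (hv : ‖v‖ = 1) {W : ℝ → ℝ} (hW : Continuous W) {c : ℝ}
    (hc : ∀ g ∈ Icc (-(1 / 2 : ℝ)) (1 / 2), |W g| ≤ c) (f : ℝ) :
    ∫ g in (-(1 / 2 : ℝ))..(1 / 2), W g ^ 2 * ‖window v (f + g)‖ ^ 2 ≤ c ^ 2 := by
  have h1 : ∫ g in (-(1 / 2 : ℝ))..(1 / 2), c ^ 2 * ‖window v (f + g)‖ ^ 2 = c ^ 2 := by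
    simp only [add_comm f]
    rw [intervalIntegral.integral_const_mul,
      integral_period_shift (norm_window_sq_periodic v) f, integral_norm_window_sq,
      real_inner_self_eq_norm_sq, hv]
    ring
  rw [← h1]
  refine intervalIntegral.integral_mono_on (by norm_num)
    (Continuous.intervalIntegrable (by fun_prop) _ _)
    (Continuous.intervalIntegrable (by fun_prop) _ _) fun g hg => ?_
  have := pow_le_pow_left₀ (abs_nonneg _) (hc g hg) 2
  rw [sq_abs] at this
  gcongr

/-! ### Asymptotics of the variance -/

/-- Parseval turns a constant density into the Gram matrix; with `c = T f` the remaining weight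
vanishes at the centre of the window. -/
theorem spectralForm_eq_add {N : ℕ} {T : ℝ → ℝ} (hT : Continuous T)
    (v w : EuclideanSpace ℝ (Fin N)) (f c : ℝ) : spectralForm T v w f =
      ((c * inner ℝ v w : ℝ) : ℂ) + spectralForm (fun g => T g - c) v w f := by
  have h1 : ∫ g in (-(1 / 2 : ℝ))..(1 / 2), window v (f - g) * window w (g - f) =
      ((inner ℝ v w : ℝ) : ℂ) := by
    rw [← integral_window_mul_window_neg,
      ← integral_period_reflect (Φ := fun h => window v h * window w (-h)) _ f]
    · simp only [neg_sub]
    · intro g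
      have h3 : -(g + 1) = -g - 1 := by ring
      simp only [window_periodic v g, h3, (window_periodic w).sub_eq]
  push_cast
  rw [← h1, spectralForm, spectralForm, ← intervalIntegral.integral_const_mul,
    ← intervalIntegral.integral_add (Continuous.intervalIntegrable (by fun_prop) _ _)
      (Continuous.intervalIntegrable (by fun_prop) _ _)]
  refine intervalIntegral.integral_congr fun g _ => ?_
  push_cast
  ring

theorem pseudoSpectralForm_add {N : ℕ} {W₁ W₂ : ℝ → ℝ} (h₁ : Continuous W₁) (h₂ : Continuous W₂)
    (v w : EuclideanSpace ℝ (Fin N)) (f : ℝ) : pseudoSpectralForm (fun g => W₁ g + W₂ g) v w f =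
      pseudoSpectralForm W₁ v w f + pseudoSpectralForm W₂ v w f := by
  unfold pseudoSpectralForm
  rw [← intervalIntegral.integral_add (Continuous.intervalIntegrable (by fun_prop) _ _)
      (Continuous.intervalIntegrable (by fun_prop) _ _)]
  refine intervalIntegral.integral_congr fun g _ => ?_
  push_cast
  ring

theorem abs_sum_sum_mul_sq_le {K : ℕ} (μ : Fin K → ℝ) (c : Fin K → Fin K → ℝ)
    (hc : ∀ k l, 0 ≤ c k l) :
    |∑ k, ∑ l, μ k * μ l * c k l| ≤ ∑ k, ∑ l, |μ k * μ l| * c k l := by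
  refine (Finset.abs_sum_le_sum_abs _ _).trans (Finset.sum_le_sum fun k _ => ?_)
  refine (Finset.abs_sum_le_sum_abs _ _).trans (Finset.sum_le_sum fun l _ => ?_)
  rw [abs_mul, abs_of_nonneg (hc k l)]

/-- The covariances of the tapered Fourier transforms contribute `T(f)² ∑ μₖ²` up to a small
error. -/
theorem abs_sum_spectralForm_sub_le {N K : ℕ} {v : Fin K → EuclideanSpace ℝ (Fin N)}
    (hv : Orthonormal ℝ v) {T : ℝ → ℝ} (hT : Continuous T) {B L δ f : ℝ} (hTf : |T f| ≤ B)
    (hL0 : 0 ≤ L) (hL : ∀ g ∈ Icc (-(1 / 2 : ℝ)) (1 / 2), |T g - T f| ≤ L * circleDist (f - g))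
    (hδ0 : 0 < δ) (hδ : ∀ k, localBias (v k) ≤ δ) (μ : Fin K → ℝ) :
    |∑ k, ∑ l, μ k * μ l * ‖spectralForm T (v k) (v l) f‖ ^ 2 - T f ^ 2 * ∑ k, μ k ^ 2| ≤
      (2 * B * L * √δ + L ^ 2 * δ) * ∑ k, μ k ^ 2 := by
  set W : ℝ → ℝ := fun g => T g - T f with hW
  have hWc : Continuous W := by fun_prop
  set D : Fin K → Fin K → ℂ := fun k l => spectralForm W (v k) (v l) f with hD
  have hen : ∀ k, ∫ g in (-(1 / 2 : ℝ))..(1 / 2), W g ^ 2 * ‖window (v k) (f - g)‖ ^ 2 ≤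
      L ^ 2 * δ := fun k =>
    (integral_sq_mul_window_reflect_le (v k) hWc hL).trans
      (mul_le_mul_of_nonneg_left (hδ k) (sq_nonneg L))
  have hrow : ∀ k, ∑ l, ‖D k l‖ ^ 2 ≤ L ^ 2 * δ := fun k =>
    (sum_norm_spectralForm_row_le hv hWc f k).trans (hen k)
  have hcol : ∀ l, ∑ k, ‖D k l‖ ^ 2 ≤ L ^ 2 * δ := fun l =>
    (sum_norm_spectralForm_col_le hv hWc f l).trans (hen l)
  have hdiag : ∀ k, ‖D k k‖ ≤ L * √δ := fun k => by
    have h1 : ‖D k k‖ ^ 2 ≤ L ^ 2 * δ :=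
      (Finset.single_le_sum (f := fun l => ‖D k l‖ ^ 2) (fun l _ => by positivity)
        (Finset.mem_univ k)).trans (hrow k)
    refine (pow_le_pow_iff_left₀ (norm_nonneg _) (by positivity) two_ne_zero).1 ?_
    rwa [mul_pow, Real.sq_sqrt hδ0.le]
  -- Off the diagonal the Gram matrix is zero, so the cross term linear in `D` occurs only for `k =
  -- l`. There it is of order `√δ`; all quadratic terms are left to the Schur test.
  have hsplit : ∀ k l, ‖spectralForm T (v k) (v l) f‖ ^ 2 =
      (if k = l then T f ^ 2 + 2 * T f * (D k k).re else 0) + ‖D k l‖ ^ 2 := fun k l => by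
    rw [spectralForm_eq_add hT _ _ _ (T f), orthonormal_iff_ite.1 hv]
    split_ifs with h
    · subst h
      rw [mul_one, ← Complex.normSq_eq_norm_sq, Complex.normSq_add, Complex.normSq_ofReal,
        Complex.normSq_eq_norm_sq]
      simp only [Complex.re_ofReal_mul, Complex.conj_re, hD, hW]
      ring
    · simp [hD, hW]
  have hsum : ∑ k, ∑ l, μ k * μ l * ‖spectralForm T (v k) (v l) f‖ ^ 2 - T f ^ 2 * ∑ k, μ k ^ 2 =
      ∑ k, μ k ^ 2 * (2 * T f * (D k k).re) + ∑ k, ∑ l, μ k * μ l * ‖D k l‖ ^ 2 := by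
    simp only [hsplit, mul_add, Finset.sum_add_distrib, mul_ite, mul_zero, Finset.sum_ite_eq,
      Finset.mem_univ, if_true]
    have e₁ : ∑ k, μ k * μ k * T f ^ 2 = T f ^ 2 * ∑ k, μ k ^ 2 := by
      rw [Finset.mul_sum]; exact Finset.sum_congr rfl fun k _ => by ring
    have e₂ : ∑ k, μ k * μ k * (2 * T f * (D k k).re) =
        ∑ k, μ k ^ 2 * (2 * T f * (D k k).re) := Finset.sum_congr rfl fun k _ => by ring
    rw [e₁, e₂]
    ring
  rw [hsum]
  have h1 : |∑ k, μ k ^ 2 * (2 * T f * (D k k).re)| ≤ 2 * B * L * √δ * ∑ k, μ k ^ 2 := by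
    rw [Finset.mul_sum]
    refine (Finset.abs_sum_le_sum_abs _ _).trans (Finset.sum_le_sum fun k _ => ?_)
    rw [abs_mul, abs_of_nonneg (sq_nonneg (μ k)), abs_mul, abs_mul, abs_two]
    have := (Complex.abs_re_le_norm (D k k)).trans (hdiag k)
    have hB0 : 0 ≤ B := (abs_nonneg _).trans hTf
    calc _ ≤ μ k ^ 2 * (2 * B * (L * √δ)) := by gcongr
      _ = _ := by ring
  have h2 : |∑ k, ∑ l, μ k * μ l * ‖D k l‖ ^ 2| ≤ L ^ 2 * δ * ∑ k, μ k ^ 2 := by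
    refine (abs_sum_sum_mul_sq_le μ _ fun k l => by positivity).trans
      ((sum_abs_mul_abs_mul_le μ (fun k l => by positivity) one_pos hrow hcol).trans_eq ?_)
    ring
  refine (abs_add_le _ _).trans ((add_le_add h1 h2).trans_eq ?_)
  ring

/-- The pseudo-covariances of the tapered Fourier transforms are negligible away from the
frequencies `0` and `±1/2`. -/
theorem sum_pseudoSpectralForm_le {N K : ℕ} {v : Fin K → EuclideanSpace ℝ (Fin N)}
    (hv : Orthonormal ℝ v) {T : ℝ → ℝ} (hT : Continuous T) {η B δ f : ℝ} (hη : 0 < η)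
    (hf1 : η ≤ |f|) (hf2 : |f| ≤ 1 / 2 - η)
    (hB : ∀ g ∈ Icc (-(1 / 2 : ℝ)) (1 / 2), |T g| ≤ B) (hδ0 : 0 < δ)
    (hδ : ∀ k, localBias (v k) ≤ δ) (μ : Fin K → ℝ) :
    |∑ k, ∑ l, μ k * μ l * ‖pseudoSpectralForm T (v k) (v l) f‖ ^ 2| ≤
      2 * ((B / (2 * η)) ^ 2 + B ^ 2) * √δ * ∑ k, μ k ^ 2 := by
  have hden : ∀ g, 2 * η ≤ circleDist (f - g) + circleDist (f + g) := fun g => by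
    have h1 := circleDist_add_le (f - g) (f + g)
    have h2 := le_circleDist_two_mul hf1 hf2
    rw [show f - g + (f + g) = 2 * f by ring] at h1
    exact h2.trans h1
  have hpos : ∀ g, 0 < circleDist (f - g) + circleDist (f + g) := fun g =>
    lt_of_lt_of_le (by positivity) (hden g)
  have hd := circleDist_nonneg
  have hB0 : 0 ≤ B := (abs_nonneg _).trans (hB 0 (by constructor <;> norm_num))
  -- The weights form a partition of unity with denominator at least `2η`. `W₁` vanishes at the peak
  -- `g = f` of the first window, `W₂` at the peak `g = -f` of the second.
  set W₁ : ℝ → ℝ := fun g => T g * (circleDist (f - g) / (circleDist (f - g) + circleDist (f + g)))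
    with hW₁
  set W₂ : ℝ → ℝ := fun g => T g * (circleDist (f + g) / (circleDist (f - g) + circleDist (f + g)))
    with hW₂
  have c₁ : Continuous W₁ := hT.mul
    (Continuous.div (by fun_prop) (by fun_prop) fun g => (hpos g).ne')
  have c₂ : Continuous W₂ := hT.mul
    (Continuous.div (by fun_prop) (by fun_prop) fun g => (hpos g).ne')
  have hTW : T = fun g => W₁ g + W₂ g := by
    ext g
    simp only [hW₁, hW₂]
    have := (hpos g).ne'
    field_simp
  have bdd : ∀ a b t : ℝ, 0 ≤ a → 0 ≤ b → 2 * η ≤ a + b → |t| ≤ B →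
      |t * (a / (a + b))| ≤ B ∧ |t * (a / (a + b))| ≤ B / (2 * η) * a := by
    intro a b t ha hb hab ht
    have hab0 : 0 < a + b := lt_of_lt_of_le (by positivity) hab
    rw [abs_mul, abs_of_nonneg (by positivity : 0 ≤ a / (a + b))]
    constructor
    · calc |t| * (a / (a + b)) ≤ B * 1 := by
            gcongr
            rw [div_le_one hab0]; linarith
        _ = B := mul_one B
    · calc |t| * (a / (a + b)) ≤ B * (a / (2 * η)) := by gcongr
        _ = _ := by ring
  have b₁ := fun g hg => bdd _ _ (T g) (hd (f - g)) (hd (f + g)) (hden g) (hB g hg)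
  have b₂ : ∀ g ∈ Icc (-(1 / 2 : ℝ)) (1 / 2), |W₂ g| ≤ B ∧
      |W₂ g| ≤ B / (2 * η) * circleDist (f + g) := fun g hg => by
    have := bdd _ _ (T g) (hd (f + g)) (hd (f - g)) (by rw [add_comm]; exact hden g) (hB g hg)
    rwa [add_comm (circleDist (f + g))] at this
  have hsq : 0 ≤ (B / (2 * η)) ^ 2 := sq_nonneg _
  have row₁ : ∀ k, ∑ l, ‖pseudoSpectralForm W₁ (v k) (v l) f‖ ^ 2 ≤ (B / (2 * η)) ^ 2 * δ :=
    fun k => (sum_norm_pseudoSpectralForm_row_le hv c₁ f k).trans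
      ((integral_sq_mul_window_reflect_le (v k) c₁ fun g hg => (b₁ g hg).2).trans
        (mul_le_mul_of_nonneg_left (hδ k) hsq))
  have col₁ : ∀ l, ∑ k, ‖pseudoSpectralForm W₁ (v k) (v l) f‖ ^ 2 ≤ B ^ 2 :=
    fun l => (sum_norm_pseudoSpectralForm_col_le hv c₁ f l).trans
      (integral_sq_mul_window_shift_le_of_bounded (hv.1 l) c₁ (fun g hg => (b₁ g hg).1) f)
  have row₂ : ∀ k, ∑ l, ‖pseudoSpectralForm W₂ (v k) (v l) f‖ ^ 2 ≤ B ^ 2 :=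
    fun k => (sum_norm_pseudoSpectralForm_row_le hv c₂ f k).trans
      (integral_sq_mul_window_reflect_le_of_bounded (hv.1 k) c₂ (fun g hg => (b₂ g hg).1) f)
  have col₂ : ∀ l, ∑ k, ‖pseudoSpectralForm W₂ (v k) (v l) f‖ ^ 2 ≤ (B / (2 * η)) ^ 2 * δ :=
    fun l => (sum_norm_pseudoSpectralForm_col_le hv c₂ f l).trans
      ((integral_sq_mul_window_shift_le (v l) c₂ fun g hg => (b₂ g hg).2).trans
        (mul_le_mul_of_nonneg_left (hδ l) hsq))
  have hr : 0 < √δ := Real.sqrt_pos.2 hδ0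
  have hrr : √δ * √δ = δ := Real.mul_self_sqrt hδ0.le
  -- For `W₁` rows are `O(δ)` and columns `O(1)`; for `W₂` it is the reverse. Taking `t = 1/√δ` and
  -- `t = √δ` respectively balances both to order `√δ`.
  have s₁ := sum_abs_mul_abs_mul_le μ (c := fun k l => ‖pseudoSpectralForm W₁ (v k) (v l) f‖ ^ 2)
    (fun k l => by positivity) (inv_pos.2 hr) row₁ col₁
  have s₂ := sum_abs_mul_abs_mul_le μ (c := fun k l => ‖pseudoSpectralForm W₂ (v k) (v l) f‖ ^ 2)
    (fun k l => by positivity) hr row₂ col₂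
  have e₁ : (√δ)⁻¹ * ((B / (2 * η)) ^ 2 * δ) + B ^ 2 / (√δ)⁻¹ =
      ((B / (2 * η)) ^ 2 + B ^ 2) * √δ := by
    nth_rw 2 [← hrr]
    field_simp
  have e₂ : √δ * B ^ 2 + (B / (2 * η)) ^ 2 * δ / √δ = ((B / (2 * η)) ^ 2 + B ^ 2) * √δ := by
    nth_rw 2 [← hrr]
    field_simp
    ring
  rw [e₁] at s₁
  rw [e₂] at s₂
  refine (abs_sum_sum_mul_sq_le μ _ fun k l => by positivity).trans ?_
  have hle : ∀ k l, |μ k * μ l| * ‖pseudoSpectralForm T (v k) (v l) f‖ ^ 2 ≤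
      2 * (|μ k * μ l| * ‖pseudoSpectralForm W₁ (v k) (v l) f‖ ^ 2) +
      2 * (|μ k * μ l| * ‖pseudoSpectralForm W₂ (v k) (v l) f‖ ^ 2) := fun k l => by
    rw [hTW, pseudoSpectralForm_add c₁ c₂]
    have h1 := norm_add_le (pseudoSpectralForm W₁ (v k) (v l) f)
      (pseudoSpectralForm W₂ (v k) (v l) f)
    have h2 := pow_le_pow_left₀ (norm_nonneg _) h1 2
    have h3 : (‖pseudoSpectralForm W₁ (v k) (v l) f‖ + ‖pseudoSpectralForm W₂ (v k) (v l) f‖) ^ 2 ≤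
        2 * ‖pseudoSpectralForm W₁ (v k) (v l) f‖ ^ 2 +
        2 * ‖pseudoSpectralForm W₂ (v k) (v l) f‖ ^ 2 := by
      have := add_sq_le (a := ‖pseudoSpectralForm W₁ (v k) (v l) f‖)
        (b := ‖pseudoSpectralForm W₂ (v k) (v l) f‖)
      linarith
    calc _ ≤ |μ k * μ l| * (2 * ‖pseudoSpectralForm W₁ (v k) (v l) f‖ ^ 2 +
        2 * ‖pseudoSpectralForm W₂ (v k) (v l) f‖ ^ 2) :=
          mul_le_mul_of_nonneg_left (h2.trans h3) (abs_nonneg _)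
      _ = _ := by ring
  refine (Finset.sum_le_sum fun k _ => Finset.sum_le_sum fun l _ => hle k l).trans ?_
  simp only [Finset.sum_add_distrib, ← Finset.mul_sum]
  linarith

/-! ### Asymptotics of the bias -/

/-- The bias of a single tapered estimate to second order. -/
theorem abs_spectralForm_self_sub_le {N : ℕ} {v : EuclideanSpace ℝ (Fin N)} (hv : ‖v‖ = 1)
    {T : ℝ → ℝ} (hT : Continuous T) {f s₁ s₂ w C δ : ℝ}
    (hR : ∀ g ∈ Icc (-(1 / 2 : ℝ)) (1 / 2),
      |T g - T f - s₁ * Real.sin (2 * π * (f - g)) - 1 / 2 * s₂ * circleDist (f - g) ^ 2| ≤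
        w * circleDist (f - g) ^ 2 +
          {g | δ < circleDist (f - g)}.indicator (fun g => C * circleDist (f - g) ^ 2) g) :
    |(spectralForm T v v f).re - T f - 1 / 2 * s₂ * localBias v| ≤
      w * localBias v + C * localBiasBeyond v δ := by
  have hspec : spectralForm T v v f =
      ((∫ g in (-(1 / 2 : ℝ))..(1 / 2), T g * ‖window v (f - g)‖ ^ 2 : ℝ) : ℂ) := by
    rw [← intervalIntegral.integral_ofReal]
    refine intervalIntegral.integral_congr fun g _ => ?_
    have := window_mul_window_neg v (f - g)
    rw [neg_sub] at this
    simp only [this]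
    push_cast
    rfl
  have hone : ∫ g in (-(1 / 2 : ℝ))..(1 / 2), ‖window v (f - g)‖ ^ 2 = 1 := by
    rw [integral_period_reflect (norm_window_sq_periodic v) f, integral_norm_window_sq,
      real_inner_self_eq_norm_sq, hv]
    norm_num
  -- After recentring, which needs the sine to have period one, an odd function times the even
  -- `|V|²` is integrated over a symmetric interval.
  have hsin : ∫ g in (-(1 / 2 : ℝ))..(1 / 2),
      Real.sin (2 * π * (f - g)) * ‖window v (f - g)‖ ^ 2 = 0 := by
    rw [integral_period_reflect (Φ := fun h => Real.sin (2 * π * h) * ‖window v h‖ ^ 2)]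
    · have h1 := intervalIntegral.integral_comp_neg (a := -(1 / 2)) (b := 1 / 2)
        (fun h => Real.sin (2 * π * h) * ‖window v h‖ ^ 2)
      simp only [mul_neg, Real.sin_neg, norm_window_neg, neg_mul, intervalIntegral.integral_neg,
        neg_neg] at h1
      linarith
    · intro h
      have : 2 * π * (h + 1) = 2 * π * h + 2 * π := by ring
      simp only [window_periodic v h, this, Real.sin_add_two_pi]
  have hmain : (spectralForm T v v f).re - T f - 1 / 2 * s₂ * localBias v =
      ∫ g in (-(1 / 2 : ℝ))..(1 / 2),
        (T g - T f - s₁ * Real.sin (2 * π * (f - g)) - 1 / 2 * s₂ * circleDist (f - g) ^ 2) *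
          ‖window v (f - g)‖ ^ 2 := by
    have e : ∀ g, (T g - T f - s₁ * Real.sin (2 * π * (f - g)) -
        1 / 2 * s₂ * circleDist (f - g) ^ 2) * ‖window v (f - g)‖ ^ 2 =
        T g * ‖window v (f - g)‖ ^ 2 - T f * ‖window v (f - g)‖ ^ 2 -
        s₁ * (Real.sin (2 * π * (f - g)) * ‖window v (f - g)‖ ^ 2) -
        1 / 2 * s₂ * (circleDist (f - g) ^ 2 * ‖window v (f - g)‖ ^ 2) := fun g => by ring
    simp only [e]
    rw [intervalIntegral.integral_sub (Continuous.intervalIntegrable (by fun_prop) _ _)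
        (Continuous.intervalIntegrable (by fun_prop) _ _),
      intervalIntegral.integral_sub (Continuous.intervalIntegrable (by fun_prop) _ _)
        (Continuous.intervalIntegrable (by fun_prop) _ _),
      intervalIntegral.integral_sub (Continuous.intervalIntegrable (by fun_prop) _ _)
        (Continuous.intervalIntegrable (by fun_prop) _ _),
      intervalIntegral.integral_const_mul, intervalIntegral.integral_const_mul,
      intervalIntegral.integral_const_mul, hone, hsin, ← localBias_eq_reflect, hspec,
      Complex.ofReal_re]
    ring
  have hmeas : MeasurableSet {g | δ < circleDist (f - g)} :=
    (isOpen_lt continuous_const (by fun_prop)).measurableSet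
  have hi₁ : IntervalIntegrable (fun g => circleDist (f - g) ^ 2 * ‖window v (f - g)‖ ^ 2)
      volume (-(1 / 2)) (1 / 2) := Continuous.intervalIntegrable (by fun_prop) _ _
  have hi₂ : IntervalIntegrable ({g | δ < circleDist (f - g)}.indicator
      (fun g => circleDist (f - g) ^ 2 * ‖window v (f - g)‖ ^ 2)) volume (-(1 / 2)) (1 / 2) :=
    ⟨hi₁.1.indicator hmeas, hi₁.2.indicator hmeas⟩
  rw [hmain, localBias_eq_reflect v f, localBiasBeyond_eq_reflect v δ f,
    ← intervalIntegral.integral_const_mul, ← intervalIntegral.integral_const_mul,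
    ← intervalIntegral.integral_add (hi₁.const_mul w) (hi₂.const_mul C)]
  refine (intervalIntegral.abs_integral_le_integral_abs (by norm_num)).trans
    (intervalIntegral.integral_mono_on (by norm_num)
      (Continuous.intervalIntegrable (by fun_prop) _ _)
      ((hi₁.const_mul w).add (hi₂.const_mul C)) fun g hg => ?_)
  rw [abs_mul, abs_of_nonneg (by positivity : 0 ≤ ‖window v (f - g)‖ ^ 2)]
  refine (mul_le_mul_of_nonneg_right (hR g hg) (by positivity)).trans_eq ?_
  simp only [Set.indicator]
  split_ifs <;> ring

theorem abs_sin_sub_le (x : ℝ) : |Real.sin x - x| ≤ |x| ^ 3 / 2 := by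
  have h := (convex_uIcc (0 : ℝ) x).norm_image_sub_le_of_norm_hasDerivWithin_le
    (f := fun t => Real.sin t - t) (f' := fun t => Real.cos t - 1) (C := |x| ^ 2 / 2)
    (fun t _ => ((Real.hasDerivAt_sin t).sub (hasDerivAt_id t)).hasDerivWithinAt)
    (fun t ht => by
      rw [Real.norm_eq_abs, abs_sub_comm, abs_of_nonneg (by linarith [Real.cos_le_one t])]
      have h1 := Real.one_sub_sq_div_two_le_cos (x := t)
      have h2 : |t| ≤ |x| := by simpa using abs_sub_left_of_mem_uIcc ht
      have h3 := pow_le_pow_left₀ (abs_nonneg t) h2 2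
      rw [sq_abs] at h3
      linarith) left_mem_uIcc right_mem_uIcc
  simp only [Real.sin_zero, sub_zero, Real.norm_eq_abs] at h
  refine h.trans_eq ?_
  ring

/-- Second order Taylor expansion under a bound for the oscillation of the second derivative. -/
theorem abs_taylor_two_le {s : Set ℝ} {F F' F'' : ℝ → ℝ} {f g w : ℝ} (hsub : uIcc f g ⊆ s)
    (h₁ : ∀ t ∈ s, HasDerivWithinAt F (F' t) s t) (h₂ : ∀ t ∈ s, HasDerivWithinAt F' (F'' t) s t)
    (hw : ∀ t ∈ uIcc f g, |F'' t - F'' f| ≤ w) :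
    |F g - F f - F' f * (g - f) - 1 / 2 * F'' f * (g - f) ^ 2| ≤ w * |f - g| ^ 2 := by
  have hw0 : 0 ≤ w := (abs_nonneg _).trans (hw f left_mem_uIcc)
  -- The mean value inequality is applied twice, first to `F'` and then to `F`, each time after
  -- removing the expected polynomial. Each use costs a factor `|f - g|`.
  have d₂ : ∀ t ∈ uIcc f g, |F' t - F' f - F'' f * (t - f)| ≤ w * |f - g| := fun t ht => by
    have h := (convex_uIcc f g).norm_image_sub_le_of_norm_hasDerivWithin_le
      (f := fun t => F' t - F'' f * t) (f' := fun t => F'' t - F'' f * 1) (C := w)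
      (fun t ht => ((h₂ t (hsub ht)).mono hsub).sub
        (((hasDerivAt_id t).const_mul (F'' f)).hasDerivWithinAt))
      (fun t ht => by rw [mul_one]; exact hw t ht) left_mem_uIcc ht
    rw [Real.norm_eq_abs, Real.norm_eq_abs] at h
    have h2 : |t - f| ≤ |f - g| := by
      rw [abs_sub_comm f g]; exact abs_sub_left_of_mem_uIcc ht
    calc |F' t - F' f - F'' f * (t - f)| = |F' t - F'' f * t - (F' f - F'' f * f)| := by
          congr 1; ring
      _ ≤ w * |t - f| := h
      _ ≤ w * |f - g| := by gcongr
  have h := (convex_uIcc f g).norm_image_sub_le_of_norm_hasDerivWithin_le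
    (f := fun t => F t - F' f * t - 1 / 2 * F'' f * (t - f) ^ 2)
    (f' := fun t => F' t - F' f - F'' f * (t - f)) (C := w * |f - g|)
    (fun t ht => by
      have hq : HasDerivAt (fun t : ℝ => 1 / 2 * F'' f * (t - f) ^ 2) (F'' f * (t - f)) t := by
        refine ((((hasDerivAt_id t).sub_const f).pow 2).const_mul (1 / 2 * F'' f)).congr_deriv ?_
        simp
        ring
      have hl : HasDerivAt (fun t : ℝ => F' f * t) (F' f) t := by
        simpa using (hasDerivAt_id t).const_mul (F' f)
      exact (((h₁ t (hsub ht)).mono hsub).sub hl.hasDerivWithinAt).sub hq.hasDerivWithinAt)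
    d₂ left_mem_uIcc right_mem_uIcc
  rw [Real.norm_eq_abs, Real.norm_eq_abs, abs_sub_comm g f] at h
  calc _ = |F g - F' f * g - 1 / 2 * F'' f * (g - f) ^ 2 -
        (F f - F' f * f - 1 / 2 * F'' f * (f - f) ^ 2)| := by congr 1; ring
    _ ≤ _ := h
    _ = _ := by ring

/-- Smoothness is known only within the closed band, while the loss uses the two-sided derivative;
the two agree at interior points. -/
theorem iteratedDeriv_two_eq_derivWithin {S : ℝ → ℝ} {s : Set ℝ} {f : ℝ} (hf : f ∈ interior s) :
    iteratedDeriv 2 S f = derivWithin (derivWithin S s) s f := by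
  rw [iteratedDeriv_succ, iteratedDeriv_one,
    derivWithin_of_mem_nhds (f := derivWithin S s) (mem_interior_iff_mem_nhds.1 hf)]
  refine Filter.EventuallyEq.deriv_eq ?_
  filter_upwards [isOpen_interior.mem_nhds hf] with g hg
  exact (derivWithin_of_mem_nhds (mem_interior_iff_mem_nhds.1 hg)).symm

theorem exists_abs_le_of_continuousOn_band {F : ℝ → ℝ}
    (hF : ContinuousOn F (Icc (-(1 / 2 : ℝ)) (1 / 2))) :
    ∃ B, 0 ≤ B ∧ ∀ g ∈ Icc (-(1 / 2 : ℝ)) (1 / 2), |F g| ≤ B := by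
  obtain ⟨B, hB⟩ := isCompact_Icc.exists_bound_of_continuousOn hF
  exact ⟨max B 0, le_max_right _ _, fun g hg => (hB g hg).trans (le_max_left _ _)⟩

/-- Uniform second order expansion of a twice continuously differentiable spectral density around
the frequencies at distance `η` from the edges of the band, with a first order term that is
periodic and odd. -/
theorem exists_uniform_expansion {S : ℝ → ℝ} (hS : ContDiffOn ℝ 2 S (Icc (-(1 / 2 : ℝ)) (1 / 2)))
    {η : ℝ} (hη : 0 < η) : ∃ B L M C : ℝ, 0 ≤ B ∧ 0 ≤ L ∧ 0 ≤ M ∧ 0 ≤ C ∧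
      (∀ g ∈ Icc (-(1 / 2 : ℝ)) (1 / 2), |S g| ≤ B) ∧
      (∀ f : ℝ, |f| ≤ 1 / 2 - η → |iteratedDeriv 2 S f| ≤ M) ∧
      (∀ f : ℝ, |f| ≤ 1 / 2 - η → ∀ g ∈ Icc (-(1 / 2 : ℝ)) (1 / 2),
        |S g - S f| ≤ L * circleDist (f - g)) ∧
      ∀ w : ℝ, 0 < w → ∃ δ₀ : ℝ, 0 < δ₀ ∧ ∀ δ ≤ δ₀, ∀ f : ℝ, |f| ≤ 1 / 2 - η →
        ∃ s₁ : ℝ, ∀ g ∈ Icc (-(1 / 2 : ℝ)) (1 / 2),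
          |S g - S f - s₁ * Real.sin (2 * π * (f - g)) -
              1 / 2 * iteratedDeriv 2 S f * circleDist (f - g) ^ 2| ≤
            w * circleDist (f - g) ^ 2 +
              {g | δ < circleDist (f - g)}.indicator (fun g => C * circleDist (f - g) ^ 2) g := by
  set I : Set ℝ := Icc (-(1 / 2 : ℝ)) (1 / 2) with hI
  have hu : UniqueDiffOn ℝ I := uniqueDiffOn_Icc (by norm_num)
  set S' := derivWithin S I with hS'
  set S'' := derivWithin S' I with hS''
  have c1 : ContDiffOn ℝ 1 S' I := hS.derivWithin hu (by norm_num)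
  have c0 : ContinuousOn S'' I := c1.continuousOn_derivWithin hu le_rfl
  have h₁ : ∀ t ∈ I, HasDerivWithinAt S (S' t) I t := fun t ht =>
    (hS.differentiableOn (by norm_num) t ht).hasDerivWithinAt
  have h₂ : ∀ t ∈ I, HasDerivWithinAt S' (S'' t) I t := fun t ht =>
    (c1.differentiableOn (by norm_num) t ht).hasDerivWithinAt
  obtain ⟨B, hB0, hB⟩ := exists_abs_le_of_continuousOn_band hS.continuousOn
  obtain ⟨B₁, hB₁0, hB₁⟩ := exists_abs_le_of_continuousOn_band c1.continuousOn
  obtain ⟨B₂, hB₂0, hB₂⟩ := exists_abs_le_of_continuousOn_band c0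
  have hfI : ∀ f : ℝ, |f| ≤ 1 / 2 - η → f ∈ I := fun f hf => by
    have := abs_le.1 hf
    exact ⟨by linarith, by linarith⟩
  have hit : ∀ f : ℝ, |f| ≤ 1 / 2 - η → iteratedDeriv 2 S f = S'' f := fun f hf => by
    refine iteratedDeriv_two_eq_derivWithin ?_
    have := abs_le.1 hf
    rw [hI, interior_Icc]
    exact ⟨by linarith, by linarith⟩
  have hd := circleDist_nonneg
  have hη2 : 0 < η ^ 2 := by positivity
  have hsub : ∀ f ∈ I, ∀ g ∈ I, uIcc f g ⊆ I := fun f hf g hg =>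
    (convex_Icc _ _).ordConnected.uIcc_subset hf hg
  -- the error of the expansion when there is no wrap-around
  have hnear : ∀ f ∈ I, ∀ g ∈ I, ∀ w, circleDist (f - g) = |f - g| →
      (∀ t ∈ uIcc f g, |S'' t - S'' f| ≤ w) →
      |S g - S f - -(S' f / (2 * π)) * Real.sin (2 * π * (f - g)) -
        1 / 2 * S'' f * circleDist (f - g) ^ 2| ≤
      w * circleDist (f - g) ^ 2 + 2 * π ^ 2 * B₁ * circleDist (f - g) ^ 3 := by
    intro f hf g hg w hdist hw
    have t1 := abs_taylor_two_le (hsub f hf g hg) h₁ h₂ hw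
    have t2 := abs_sin_sub_le (2 * π * (f - g))
    have t3 : |S' f / (2 * π) * (Real.sin (2 * π * (f - g)) - 2 * π * (f - g))| ≤
        2 * π ^ 2 * B₁ * |f - g| ^ 3 := by
      rw [abs_mul, abs_div, abs_of_pos Real.two_pi_pos]
      rw [abs_mul, abs_of_pos Real.two_pi_pos] at t2
      calc _ ≤ B₁ / (2 * π) * ((2 * π * |f - g|) ^ 3 / 2) := by
            gcongr
            exact hB₁ f hf
        _ = _ := by
            field_simp [Real.pi_ne_zero]
    rw [hdist]
    refine le_trans (le_of_eq ?_) ((abs_add_le _ _).trans (add_le_add t1 t3))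
    congr 1
    rw [sq_abs]
    field_simp [Real.pi_ne_zero]
    ring
  -- the error of the expansion far from the center
  have hfar : ∀ f ∈ I, ∀ g ∈ I, η ≤ circleDist (f - g) →
      |S g - S f - -(S' f / (2 * π)) * Real.sin (2 * π * (f - g)) -
        1 / 2 * S'' f * circleDist (f - g) ^ 2| ≤
      (2 * B + B₁ + B₂) / η ^ 2 * circleDist (f - g) ^ 2 := by
    intro f hf g hg hdist
    have hle : circleDist (f - g) ≤ 1 / 2 := by
      have := AddCircle.norm_le_half_period (1 : ℝ) (x := ((f - g : ℝ) : UnitAddCircle)) one_ne_zero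
      simpa [circleDist] using this
    have hsq : circleDist (f - g) ^ 2 ≤ 1 := by nlinarith [hd (f - g)]
    have e1 : |S' f / (2 * π) * Real.sin (2 * π * (f - g))| ≤ B₁ := by
      rw [abs_mul, abs_div, abs_of_pos Real.two_pi_pos]
      calc _ ≤ B₁ / 1 * 1 := by
            gcongr
            · exact hB₁ f hf
            · linarith [Real.pi_gt_three]
            · exact Real.abs_sin_le_one _
        _ = B₁ := by ring
    have e2 : |1 / 2 * S'' f * circleDist (f - g) ^ 2| ≤ B₂ := by
      rw [abs_mul, abs_mul, abs_of_nonneg (sq_nonneg (circleDist (f - g)))]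
      calc _ ≤ |(1 / 2 : ℝ)| * B₂ * 1 := by
            gcongr
            exact hB₂ f hf
        _ ≤ B₂ := by rw [abs_of_pos (by norm_num)]; linarith
    have e3 : 2 * B + B₁ + B₂ ≤ (2 * B + B₁ + B₂) / η ^ 2 * circleDist (f - g) ^ 2 := by
      rw [div_mul_eq_mul_div, le_div_iff₀ hη2]
      gcongr
    refine le_trans ?_ e3
    have a1 := abs_le.1 (hB g hg)
    have a2 := abs_le.1 (hB f hf)
    have a3 := abs_le.1 e1
    have a4 := abs_le.1 e2
    rw [abs_le, neg_mul]
    constructor <;> linarith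
  -- In the Lipschitz constant `B₁` serves the case without wrap-around and `2B/η` the wrapped case,
  -- where the distance is at least `η`. In the last constant, `2B₂ + π²B₁` covers Taylor and sine
  -- errors (using distance at most `1/2`), and the quotient by `η²` covers wrap-around.
  refine ⟨B, B₁ + 2 * B / η, B₂, 2 * B₂ + π ^ 2 * B₁ + (2 * B + B₁ + B₂) / η ^ 2, hB0,
    by positivity, hB₂0, by positivity, hB, fun f hf => ?_, fun f hf g hg => ?_, fun w hw => ?_⟩
  · rw [hit f hf]
    exact hB₂ f (hfI f hf)
  · rcases circleDist_sub_cases hf hg with h | h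
    · have := (convex_Icc (-(1 / 2 : ℝ)) (1 / 2)).norm_image_sub_le_of_norm_hasDerivWithin_le
        h₁ hB₁ (hfI f hf) hg
      rw [Real.norm_eq_abs, Real.norm_eq_abs, abs_sub_comm g f] at this
      rw [h]
      refine this.trans ?_
      gcongr
      linarith [div_nonneg (mul_nonneg zero_le_two hB0) hη.le]
    · have a1 := abs_le.1 (hB g hg)
      have a2 := abs_le.1 (hB f (hfI f hf))
      have a3 : |S g - S f| ≤ 2 * B := by rw [abs_le]; constructor <;> linarith
      have a4 : 2 * B ≤ 2 * B / η * circleDist (f - g) := by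
        rw [div_mul_eq_mul_div, le_div_iff₀ hη]
        gcongr
      nlinarith [mul_nonneg hB₁0 (hd (f - g))]
  · have huc := isCompact_Icc.uniformContinuousOn_of_continuous c0
    rw [Metric.uniformContinuousOn_iff] at huc
    obtain ⟨ρ, hρ, hρ'⟩ := huc (w / 2) (by positivity)
    -- Below `η` there is no wrap-around; below `ρ` the oscillation of `S''` costs at most `w/2`;
    -- the last bound makes the cubic sine error cost at most `w/2`. The slope is `-S'(f)/(2π)`
    -- because the sine is in `f - g`, not `g - f`.
    refine ⟨min (min (η / 2) (ρ / 2)) (w / (4 * π ^ 2 * B₁ + 1)), by positivity,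
      fun δ hδ f hf => ⟨-(S' f / (2 * π)), fun g hg => ?_⟩⟩
    have hδη : δ < η := by
      have := (hδ.trans (min_le_left _ _)).trans (min_le_left _ _); linarith
    have hδρ : δ < ρ := by
      have := (hδ.trans (min_le_left _ _)).trans (min_le_right _ _); linarith
    have hδw : δ * (4 * π ^ 2 * B₁ + 1) ≤ w := by
      have := hδ.trans (min_le_right _ _)
      rwa [le_div_iff₀ (by positivity)] at this
    rw [hit f hf]
    simp only [Set.indicator, mem_ofPred_eq]
    have hd0 := hd (f - g)
    have hd2 : 0 ≤ circleDist (f - g) ^ 2 := by positivity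
    split_ifs with hlt
    · have hC : |S g - S f - -(S' f / (2 * π)) * Real.sin (2 * π * (f - g)) -
          1 / 2 * S'' f * circleDist (f - g) ^ 2| ≤
          (2 * B₂ + π ^ 2 * B₁ + (2 * B + B₁ + B₂) / η ^ 2) * circleDist (f - g) ^ 2 := by
        rcases circleDist_sub_cases hf hg with h | h
        · have h1 := hnear f (hfI f hf) g hg (2 * B₂) h fun t ht => by
            have a1 := abs_le.1 (hB₂ t (hsub f (hfI f hf) g hg ht))
            have a2 := abs_le.1 (hB₂ f (hfI f hf))
            rw [abs_le]; constructor <;> linarith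
          have hle : circleDist (f - g) ≤ 1 / 2 := by
            have := AddCircle.norm_le_half_period (1 : ℝ) (x := ((f - g : ℝ) : UnitAddCircle))
              one_ne_zero
            simpa [circleDist] using this
          have h2 : 2 * π ^ 2 * B₁ * circleDist (f - g) ^ 3 ≤
              π ^ 2 * B₁ * circleDist (f - g) ^ 2 := by
            calc _ = 2 * π ^ 2 * B₁ * circleDist (f - g) ^ 2 * circleDist (f - g) := by ring
              _ ≤ 2 * π ^ 2 * B₁ * circleDist (f - g) ^ 2 * (1 / 2) := by gcongr
              _ = _ := by ring
          have h3 : 0 ≤ (2 * B + B₁ + B₂) / η ^ 2 * circleDist (f - g) ^ 2 := by positivity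
          linarith
        · have h1 := hfar f (hfI f hf) g hg h
          have h3 : 0 ≤ (2 * B₂ + π ^ 2 * B₁) * circleDist (f - g) ^ 2 := by positivity
          linarith
      have : 0 ≤ w * circleDist (f - g) ^ 2 := by positivity
      linarith
    · rw [not_lt] at hlt
      rcases circleDist_sub_cases hf hg with h | h
      · have h1 := hnear f (hfI f hf) g hg (w / 2) h fun t ht => by
          refine le_of_lt (hρ' t (hsub f (hfI f hf) g hg ht) f (hfI f hf) ?_)
          rw [Real.dist_eq]
          refine lt_of_le_of_lt (abs_sub_left_of_mem_uIcc ht) ?_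
          rw [abs_sub_comm, ← h]
          linarith
        have h2 : 2 * π ^ 2 * B₁ * circleDist (f - g) ^ 3 ≤ w / 2 * circleDist (f - g) ^ 2 := by
          have h3 : 2 * π ^ 2 * B₁ * circleDist (f - g) ≤ w / 2 := by
            have h4 : 4 * π ^ 2 * B₁ * circleDist (f - g) ≤ 4 * π ^ 2 * B₁ * δ := by gcongr
            nlinarith
          calc _ = 2 * π ^ 2 * B₁ * circleDist (f - g) * circleDist (f - g) ^ 2 := by ring
            _ ≤ _ := by gcongr
        linarith
      · linarith

/-! ### Windows of tapers satisfying a three term recurrence -/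

theorem exp_neg_two_pi_mul_eq_pow (n : ℕ) (h : ℝ) :
    Complex.exp (-(2 * π * Complex.I * (n : ℂ) * (h : ℂ))) =
      Complex.exp (-(2 * π * Complex.I * (h : ℂ))) ^ n := by
  rw [← Complex.exp_nat_mul]
  congr 1
  ring

theorem two_cos_two_pi_eq (h : ℝ) : ((2 * Real.cos (2 * π * h) : ℝ) : ℂ) =
    Complex.exp (-(2 * π * Complex.I * (h : ℂ))) +
      (Complex.exp (-(2 * π * Complex.I * (h : ℂ))))⁻¹ := by
  rw [← Complex.exp_neg, neg_neg]
  push_cast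
  rw [Complex.cos]
  have : 2 * (π : ℂ) * (h : ℂ) * Complex.I = 2 * π * Complex.I * h := by ring
  rw [neg_mul, this]
  ring

/-- A three term recurrence turns into multiplication by a cosine on the Fourier side, up to
boundary terms. -/
theorem recurrence_sum {a : ℕ → ℝ} {c : ℝ} (h0 : a 0 = 0)
    (ha : ∀ n, a (n + 2) + a n = 2 * c * a (n + 1)) {z : ℂ} (hz : z ≠ 0) (N : ℕ) :
    (z + z⁻¹ - ((2 * c : ℝ) : ℂ)) * ∑ n ∈ Finset.range N, (a (n + 1) : ℂ) * z ^ (n + 1) =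
      a 1 + a N * z ^ (N + 1) - a (N + 1) * z ^ N := by
  induction N with
  | zero => simp [h0]
  | succ N ih =>
    rw [Finset.sum_range_succ, mul_add, ih]
    have h1 : (a (N + 2) : ℂ) = ((2 * c : ℝ) : ℂ) * a (N + 1) - a N := by
      rw [← Complex.ofReal_mul, ← ha]; push_cast; ring
    rw [show N + 1 + 1 = N + 2 from rfl, h1]
    field_simp
    ring

section Recurrence

variable {N : ℕ} {v : EuclideanSpace ℝ (Fin N)} {a : ℕ → ℝ} {c : ℝ}

theorem window_eq_sum_range (hv : ∀ n : Fin N, v n = a ((n : ℕ) + 1)) (h : ℝ) :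
    window v h = ∑ n ∈ Finset.range N, (a (n + 1) : ℂ) *
      Complex.exp (-(2 * π * Complex.I * (h : ℂ))) ^ (n + 1) := by
  rw [← Fin.sum_univ_eq_sum_range
    (fun n => (a (n + 1) : ℂ) * Complex.exp (-(2 * π * Complex.I * (h : ℂ))) ^ (n + 1))]
  unfold window fourier
  refine Finset.sum_congr rfl fun n _ => ?_
  simp only [hv]
  rw [exp_neg_two_pi_mul_eq_pow]

theorem cos_sub_mul_window (hv : ∀ n : Fin N, v n = a ((n : ℕ) + 1)) (h0 : a 0 = 0)
    (hN : a (N + 1) = 0) (ha : ∀ n, a (n + 2) + a n = 2 * c * a (n + 1)) (h : ℝ) :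
    ((2 * Real.cos (2 * π * h) - 2 * c : ℝ) : ℂ) * window v h =
      a 1 + a N * Complex.exp (-(2 * π * Complex.I * ((N + 1 : ℕ) : ℂ) * (h : ℂ))) := by
  rw [Complex.ofReal_sub, two_cos_two_pi_eq, window_eq_sum_range hv,
    recurrence_sum h0 ha (Complex.exp_ne_zero _), exp_neg_two_pi_mul_eq_pow, hN]
  simp

/-- The boundary times `0` and `N + 1` lie just outside the support `1, …, N` of the taper, so their
exponentials are orthogonal to the window. -/
theorem integral_exp_mul_window_neg (v : EuclideanSpace ℝ (Fin N)) (m : ℕ)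
    (hm : m = 0 ∨ m = N + 1) : ∫ h in (-(1 / 2 : ℝ))..(1 / 2),
      Complex.exp (-(2 * π * Complex.I * (m : ℂ) * (h : ℂ))) * window v (-h) = 0 := by
  unfold window fourier
  simp only [Finset.mul_sum]
  rw [intervalIntegral.integral_finsetSum fun n _ =>
    Continuous.intervalIntegrable (by fun_prop) _ _]
  refine Finset.sum_eq_zero fun n _ => ?_
  have h1 : ∀ h : ℝ, Complex.exp (-(2 * π * Complex.I * (m : ℂ) * (h : ℂ))) * ((v n : ℂ) *
      Complex.exp (-(2 * π * Complex.I * (((n : ℕ) + 1 : ℕ) : ℂ) * ((-h : ℝ) : ℂ)))) =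
      (v n : ℂ) * Complex.exp (2 * π * Complex.I *
        (((((n : ℕ) + 1 : ℕ) : ℤ) - (m : ℤ) : ℤ) : ℂ) * (h : ℂ)) := fun h => by
    rw [mul_left_comm, ← Complex.exp_add]
    congr 2
    push_cast
    ring
  simp only [h1]
  rw [intervalIntegral.integral_const_mul, integral_exp_int, if_neg, mul_zero]
  have := n.2
  omega

theorem integral_cos_mul_window_sq (hv : ∀ n : Fin N, v n = a ((n : ℕ) + 1)) (h0 : a 0 = 0)
    (hN : a (N + 1) = 0) (ha : ∀ n, a (n + 2) + a n = 2 * c * a (n + 1)) :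
    ∫ h in (-(1 / 2 : ℝ))..(1 / 2), (2 * Real.cos (2 * π * h) - 2 * c) * ‖window v h‖ ^ 2 = 0 := by
  have h1 : ∀ h : ℝ, (((2 * Real.cos (2 * π * h) - 2 * c) * ‖window v h‖ ^ 2 : ℝ) : ℂ) =
      (a 1 : ℂ) * (Complex.exp (-(2 * π * Complex.I * ((0 : ℕ) : ℂ) * (h : ℂ))) * window v (-h)) +
      (a N : ℂ) * (Complex.exp (-(2 * π * Complex.I * ((N + 1 : ℕ) : ℂ) * (h : ℂ))) *
        window v (-h)) := fun h => by
    rw [Complex.ofReal_mul, ← window_mul_window_neg, ← mul_assoc,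
      cos_sub_mul_window hv h0 hN ha]
    simp
    ring
  apply Complex.ofReal_injective
  rw [← intervalIntegral.integral_ofReal]
  simp only [h1]
  rw [intervalIntegral.integral_add (Continuous.intervalIntegrable (by fun_prop) _ _)
      (Continuous.intervalIntegrable (by fun_prop) _ _), intervalIntegral.integral_const_mul,
    intervalIntegral.integral_const_mul, integral_exp_mul_window_neg v 0 (Or.inl rfl),
    integral_exp_mul_window_neg v (N + 1) (Or.inr rfl)]
  simp

theorem two_sub_two_cos_eq (x : ℝ) : 2 - 2 * Real.cos (2 * x) = 4 * Real.sin x ^ 2 := by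
  rw [Real.cos_two_mul, Real.cos_sq']
  ring

/-- `sin² πh` equals `(1 - c)/2` minus a quarter of `2 cos 2πh - 2c`, and the latter has zero mean
against `|V|²` since the boundary terms are orthogonal to the window. -/
theorem integral_sin_sq_mul_window_sq (hn : ‖v‖ = 1) (hv : ∀ n : Fin N, v n = a ((n : ℕ) + 1))
    (h0 : a 0 = 0) (hN : a (N + 1) = 0) (ha : ∀ n, a (n + 2) + a n = 2 * c * a (n + 1)) :
    ∫ h in (-(1 / 2 : ℝ))..(1 / 2), Real.sin (π * h) ^ 2 * ‖window v h‖ ^ 2 = (1 - c) / 2 := by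
  have h1 := integral_cos_mul_window_sq hv h0 hN ha
  have h2 := integral_norm_window_sq v
  rw [real_inner_self_eq_norm_sq, hn] at h2
  have h3 : ∀ h : ℝ, Real.sin (π * h) ^ 2 * ‖window v h‖ ^ 2 = (1 - c) / 2 * ‖window v h‖ ^ 2 -
      1 / 4 * ((2 * Real.cos (2 * π * h) - 2 * c) * ‖window v h‖ ^ 2) := fun h => by
    have := two_sub_two_cos_eq (π * h)
    rw [← mul_assoc] at this
    linear_combination (-(1 / 4) * ‖window v h‖ ^ 2) * this
  simp only [h3]
  rw [intervalIntegral.integral_sub (Continuous.intervalIntegrable (by fun_prop) _ _)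
    (Continuous.intervalIntegrable (by fun_prop) _ _), intervalIntegral.integral_const_mul,
    intervalIntegral.integral_const_mul, h1, h2]
  ring

/-- `16 sin⁴ πh = (2 - 2 cos 2πh)²`; splitting at `2c` leaves a constant and the square of `2 cos
2πh - 2c`, which times `|V|²` is the squared modulus of the two boundary terms. -/
theorem integral_sin_pow_four_mul_window_sq_le (hn : ‖v‖ = 1)
    (hv : ∀ n : Fin N, v n = a ((n : ℕ) + 1)) (h0 : a 0 = 0) (hN : a (N + 1) = 0)
    (ha : ∀ n, a (n + 2) + a n = 2 * c * a (n + 1)) :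
    ∫ h in (-(1 / 2 : ℝ))..(1 / 2), 16 * Real.sin (π * h) ^ 4 * ‖window v h‖ ^ 2 ≤
      2 * (2 - 2 * c) ^ 2 + 2 * (|a 1| + |a N|) ^ 2 := by
  have h2 := integral_norm_window_sq v
  rw [real_inner_self_eq_norm_sq, hn] at h2
  have hpt : ∀ h : ℝ, 16 * Real.sin (π * h) ^ 4 * ‖window v h‖ ^ 2 ≤
      2 * (2 - 2 * c) ^ 2 * ‖window v h‖ ^ 2 + 2 * (|a 1| + |a N|) ^ 2 := fun h => by
    have e := two_sub_two_cos_eq (π * h)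
    rw [← mul_assoc] at e
    have hD : ‖((2 * Real.cos (2 * π * h) - 2 * c : ℝ) : ℂ) * window v h‖ ≤ |a 1| + |a N| := by
      rw [cos_sub_mul_window hv h0 hN ha]
      refine (norm_add_le _ _).trans_eq ?_
      rw [norm_mul, Complex.norm_real, Complex.norm_real, Real.norm_eq_abs, Real.norm_eq_abs]
      have : -(2 * π * Complex.I * ((N + 1 : ℕ) : ℂ) * (h : ℂ)) =
          ((-(2 * π * (N + 1 : ℕ) * h) : ℝ) : ℂ) * Complex.I := by push_cast; ring
      rw [this, Complex.norm_exp_ofReal_mul_I, mul_one]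
    rw [norm_mul, Complex.norm_real, Real.norm_eq_abs] at hD
    have hD2 := pow_le_pow_left₀ (by positivity) hD 2
    rw [mul_pow, sq_abs] at hD2
    have e2 : 16 * Real.sin (π * h) ^ 4 =
        ((2 - 2 * c) - (2 * Real.cos (2 * π * h) - 2 * c)) ^ 2 := by
      rw [show (2 - 2 * c) - (2 * Real.cos (2 * π * h) - 2 * c) = 2 - 2 * Real.cos (2 * π * h) by
        ring, e]
      ring
    rw [e2]
    have e3 : ((2 - 2 * c) - (2 * Real.cos (2 * π * h) - 2 * c)) ^ 2 ≤
        2 * (2 - 2 * c) ^ 2 + 2 * (2 * Real.cos (2 * π * h) - 2 * c) ^ 2 := by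
      nlinarith [sq_nonneg ((2 - 2 * c) + (2 * Real.cos (2 * π * h) - 2 * c))]
    have e4 := mul_le_mul_of_nonneg_right e3 (by positivity : 0 ≤ ‖window v h‖ ^ 2)
    linarith
  refine (intervalIntegral.integral_mono_on (by norm_num)
    (Continuous.intervalIntegrable (by fun_prop) _ _)
    (Continuous.intervalIntegrable (by fun_prop) _ _) fun h _ => hpt h).trans_eq ?_
  rw [intervalIntegral.integral_add (Continuous.intervalIntegrable (by fun_prop) _ _)
    (Continuous.intervalIntegrable (by fun_prop) _ _), intervalIntegral.integral_const_mul, h2,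
    intervalIntegral.integral_const]
  simp
  norm_num

end Recurrence

theorem four_mul_sq_le_sin_sq {h : ℝ} (hh : |h| ≤ 1 / 2) : 4 * h ^ 2 ≤ Real.sin (π * h) ^ 2 := by
  have h1 : 2 / π * |π * h| ≤ |Real.sin (π * h)| := by
    refine Real.mul_abs_le_abs_sin ?_
    rw [abs_mul, abs_of_pos Real.pi_pos]
    nlinarith [Real.pi_pos]
  have h2 := pow_le_pow_left₀ (by positivity) h1 2
  rw [sq_abs, abs_mul, abs_of_pos Real.pi_pos] at h2
  calc 4 * h ^ 2 = (2 / π * (π * |h|)) ^ 2 := by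
        rw [← sq_abs h]; field_simp [Real.pi_ne_zero]; ring
    _ ≤ _ := h2

theorem sin_sq_le_pi_sq_mul (h : ℝ) : Real.sin (π * h) ^ 2 ≤ π ^ 2 * h ^ 2 := by
  have h2 := pow_le_pow_left₀ (abs_nonneg _) (Real.abs_sin_le_abs (x := π * h)) 2
  rwa [sq_abs, sq_abs, mul_pow] at h2

theorem localBias_le_integral_sin {N : ℕ} (v : EuclideanSpace ℝ (Fin N)) :
    4 * localBias v ≤ ∫ h in (-(1 / 2 : ℝ))..(1 / 2), Real.sin (π * h) ^ 2 * ‖window v h‖ ^ 2 := by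
  rw [localBias, integral_Icc_eq_intervalIntegral, ← intervalIntegral.integral_const_mul]
  refine intervalIntegral.integral_mono_on (by norm_num)
    (Continuous.intervalIntegrable (by fun_prop) _ _)
    (Continuous.intervalIntegrable (by fun_prop) _ _) fun h hh => ?_
  rw [← mul_assoc]
  gcongr
  exact four_mul_sq_le_sin_sq (abs_le.2 hh)

theorem integral_sin_le_localBias {N : ℕ} (v : EuclideanSpace ℝ (Fin N)) :
    ∫ h in (-(1 / 2 : ℝ))..(1 / 2), Real.sin (π * h) ^ 2 * ‖window v h‖ ^ 2 ≤
      π ^ 2 * localBias v := by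
  rw [localBias, integral_Icc_eq_intervalIntegral, ← intervalIntegral.integral_const_mul]
  refine intervalIntegral.integral_mono_on (by norm_num)
    (Continuous.intervalIntegrable (by fun_prop) _ _)
    (Continuous.intervalIntegrable (by fun_prop) _ _) fun h hh => ?_
  rw [← mul_assoc]
  gcongr
  exact sin_sq_le_pi_sq_mul h

/-- Chebyshev's inequality: for `δ ≤ |h| ≤ 1/2`, `256 δ² h² ≤ 256 h⁴ ≤ 16 sin⁴ πh`, from `2|h| ≤
|sin πh|`. -/
theorem localBiasBeyond_le_integral_sin {N : ℕ} (v : EuclideanSpace ℝ (Fin N)) {δ : ℝ}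
    (hδ : 0 < δ) : 256 * δ ^ 2 * localBiasBeyond v δ ≤
      ∫ h in (-(1 / 2 : ℝ))..(1 / 2), 16 * Real.sin (π * h) ^ 4 * ‖window v h‖ ^ 2 := by
  have hi₁ : IntegrableOn (fun h : ℝ => h ^ 2 * ‖window v h‖ ^ 2) (Icc (-(1 / 2)) (1 / 2)) :=
    Continuous.integrableOn_Icc (by fun_prop)
  have hi₂ : IntegrableOn (fun h : ℝ => 16 * Real.sin (π * h) ^ 4 * ‖window v h‖ ^ 2)
      (Icc (-(1 / 2)) (1 / 2)) := Continuous.integrableOn_Icc (by fun_prop)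
  rw [localBiasBeyond, ← integral_Icc_eq_intervalIntegral, ← integral_const_mul]
  refine (setIntegral_mono_on ((hi₁.mono_set sdiff_subset).const_mul _)
    (hi₂.mono_set sdiff_subset) (measurableSet_Icc.diff measurableSet_Icc) fun h hh => ?_).trans
    (setIntegral_mono_set hi₂ (.of_forall fun h => by positivity)
      sdiff_subset.eventuallyLE)
  obtain ⟨h1, h2⟩ := hh
  have h3 : δ ≤ |h| := by
    by_contra hlt
    exact h2 (abs_le.1 (not_le.1 hlt).le)
  have h4 := pow_le_pow_left₀ hδ.le h3 2
  rw [sq_abs] at h4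
  have h5 := four_mul_sq_le_sin_sq (abs_le.2 h1)
  have h6 : (4 * h ^ 2) ^ 2 ≤ (Real.sin (π * h) ^ 2) ^ 2 := by gcongr
  rw [← mul_assoc]
  refine mul_le_mul_of_nonneg_right ?_ (by positivity)
  calc 256 * δ ^ 2 * h ^ 2 ≤ 256 * h ^ 2 * h ^ 2 := by gcongr
    _ = 16 * (4 * h ^ 2) ^ 2 := by ring
    _ ≤ 16 * (Real.sin (π * h) ^ 2) ^ 2 := by gcongr
    _ = _ := by ring

/-- Eigenvectors of a discrete Laplacian for distinct eigenvalues: the partial sums telescope to the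
Casoratian `a (m+1) * b m - a m * b (m+1)`, which vanishes at both ends. -/
theorem sum_mul_eq_zero_of_recurrence {N : ℕ} {a b : ℕ → ℝ} {c d : ℝ} (ha0 : a 0 = 0)
    (hb0 : b 0 = 0) (ha : ∀ n, a (n + 2) + a n = 2 * c * a (n + 1))
    (hb : ∀ n, b (n + 2) + b n = 2 * d * b (n + 1)) (haN : a (N + 1) = 0) (hbN : b (N + 1) = 0)
    (hcd : c ≠ d) : ∑ n ∈ Finset.range N, a (n + 1) * b (n + 1) = 0 := by
  have key : ∀ m, 2 * (c - d) * ∑ n ∈ Finset.range m, a (n + 1) * b (n + 1) =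
      a (m + 1) * b m - a m * b (m + 1) := by
    intro m
    induction m with
    | zero => simp [ha0, hb0]
    | succ m ih =>
      rw [Finset.sum_range_succ, mul_add, ih]
      linear_combination (-b (m + 1)) * ha m + a (m + 1) * hb m
  have h := key N
  rw [haN, hbN, zero_mul, mul_zero, sub_zero] at h
  rcases mul_eq_zero.1 h with h | h
  · exact absurd (by linarith) hcd
  · exact h

theorem sum_sin_sq {θ : ℝ} (hθ : Real.sin θ ≠ 0) {N : ℕ} (hN : Real.sin ((N + 1) * θ) = 0) :
    ∑ n ∈ Finset.range N, Real.sin ((n + 1) * θ) ^ 2 = (N + 1) / 2 := by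
  have key : ∀ m : ℕ, 2 * Real.sin θ * ∑ n ∈ Finset.range m, Real.sin ((n + 1) * θ) ^ 2 =
      m * Real.sin θ - Real.sin (m * θ) * Real.cos ((m + 1) * θ) := by
    intro m
    induction m with
    | zero => simp
    | succ m ih =>
      rw [Finset.sum_range_succ, mul_add, ih]
      push_cast
      have e1 : (m + 1 + 1 : ℝ) * θ = (m + 1) * θ + θ := by ring
      have e2 : (m : ℝ) * θ = (m + 1) * θ - θ := by ring
      rw [e1, e2, Real.sin_sub, Real.cos_add]
      linear_combination Real.sin θ * Real.sin_sq_add_cos_sq ((m + 1) * θ)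
  have h := key N
  have e2 : (N : ℝ) * θ = (N + 1) * θ - θ := by ring
  have h1 := Real.sin_sq_add_cos_sq ((N + 1) * θ)
  rw [hN] at h1
  rw [e2, Real.sin_sub, hN] at h
  have h3 : 2 * Real.sin θ * (∑ n ∈ Finset.range N, Real.sin ((n + 1) * θ) ^ 2 - (N + 1) / 2) = 0 := by
    linear_combination h + Real.sin θ * h1
  rcases mul_eq_zero.1 h3 with h4 | h4
  · exact absurd (by linarith) hθ
  · linarith

/-! ### Orthonormality and localization of the sinusoidal tapers -/

/-- The angle `πk/(N+1)` of the `k`-th sinusoidal taper. -/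
def taperAngle (N k : ℕ) : ℝ := π * ((k : ℝ) + 1) / ((N : ℝ) + 1)

/-- The sequence `√(2/(N+1)) sin(nθ)` which a sinusoidal taper samples at `n = 1, …, N`. -/
def taperSequence (N k n : ℕ) : ℝ := √(2 / ((N : ℝ) + 1)) * Real.sin (n * taperAngle N k)

theorem sinusoidalTapers_apply {N K : ℕ} (k : Fin K) (n : Fin N) :
    sinusoidalTapers N K k n = taperSequence N k ((n : ℕ) + 1) := by
  simp only [sinusoidalTapers, taperSequence, taperAngle]
  push_cast
  congr 2
  ring

theorem taperSequence_zero (N k : ℕ) : taperSequence N k 0 = 0 := by simp [taperSequence]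

theorem sin_succ_mul_taperAngle (N k : ℕ) : Real.sin ((N + 1) * taperAngle N k) = 0 := by
  have : ((N : ℝ) + 1) * taperAngle N k = ((k + 1 : ℕ) : ℝ) * π := by
    unfold taperAngle
    push_cast
    field_simp
  rw [this, Real.sin_nat_mul_pi]

theorem taperSequence_end (N k : ℕ) : taperSequence N k (N + 1) = 0 := by
  unfold taperSequence
  push_cast
  rw [sin_succ_mul_taperAngle, mul_zero]

theorem taperSequence_recurrence (N k n : ℕ) :
    taperSequence N k (n + 2) + taperSequence N k n =
      2 * Real.cos (taperAngle N k) * taperSequence N k (n + 1) := by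
  unfold taperSequence
  have e1 : ((n + 2 : ℕ) : ℝ) * taperAngle N k =
      ((n + 1 : ℕ) : ℝ) * taperAngle N k + taperAngle N k := by push_cast; ring
  have e2 : (n : ℝ) * taperAngle N k =
      ((n + 1 : ℕ) : ℝ) * taperAngle N k - taperAngle N k := by push_cast; ring
  rw [e1, e2, Real.sin_add, Real.sin_sub]
  ring

theorem taperAngle_pos (N k : ℕ) : 0 < taperAngle N k := by
  unfold taperAngle
  positivity

theorem taperAngle_lt_pi {N k : ℕ} (hk : k < N) : taperAngle N k < π := by
  unfold taperAngle
  have : (k : ℝ) < N := by exact_mod_cast hk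
  rw [div_lt_iff₀ (by positivity)]
  gcongr

theorem cos_taperAngle_injective {N k l : ℕ} (hk : k < N) (hl : l < N)
    (h : Real.cos (taperAngle N k) = Real.cos (taperAngle N l)) : k = l := by
  have h1 := Real.injOn_cos ⟨(taperAngle_pos N k).le, (taperAngle_lt_pi hk).le⟩
    ⟨(taperAngle_pos N l).le, (taperAngle_lt_pi hl).le⟩ h
  unfold taperAngle at h1
  have hN : (N : ℝ) + 1 ≠ 0 := by positivity
  field_simp [Real.pi_ne_zero] at h1
  exact_mod_cast (add_right_cancel h1 : (k : ℝ) = l)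

theorem orthonormal_sinusoidalTapers {N K : ℕ} (hK : K ≤ N) :
    Orthonormal ℝ (sinusoidalTapers N K) := by
  rw [orthonormal_iff_ite]
  intro i j
  have hi : (i : ℕ) < N := i.2.trans_le hK
  have hj : (j : ℕ) < N := j.2.trans_le hK
  rw [PiLp.inner_apply]
  simp only [RCLike.inner_apply, conj_trivial, sinusoidalTapers_apply]
  rw [Fin.sum_univ_eq_sum_range (fun n => taperSequence N j (n + 1) * taperSequence N i (n + 1))]
  split_ifs with h
  · subst h
    have h1 := sum_sin_sq (Real.sin_pos_of_pos_of_lt_pi (taperAngle_pos N i)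
      (taperAngle_lt_pi hi)).ne' (sin_succ_mul_taperAngle N i)
    have h2 : √(2 / ((N : ℝ) + 1)) ^ 2 = 2 / ((N : ℝ) + 1) := Real.sq_sqrt (by positivity)
    calc _ = √(2 / ((N : ℝ) + 1)) ^ 2 *
        ∑ n ∈ Finset.range N, Real.sin ((n + 1) * taperAngle N i) ^ 2 := by
          rw [Finset.mul_sum]
          refine Finset.sum_congr rfl fun n _ => ?_
          unfold taperSequence
          push_cast
          ring
      _ = 1 := by
          rw [h1, h2]
          field_simp
  · exact sum_mul_eq_zero_of_recurrence (taperSequence_zero N j) (taperSequence_zero N i)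
      (taperSequence_recurrence N j) (taperSequence_recurrence N i) (taperSequence_end N j)
      (taperSequence_end N i)
      fun hc => h (Fin.ext (cos_taperAngle_injective hj hi hc).symm)

theorem one_sub_cos_div_two_eq (x : ℝ) : (1 - Real.cos x) / 2 = Real.sin (x / 2) ^ 2 := by
  have := two_sub_two_cos_eq (x / 2)
  rw [mul_div_cancel₀ x two_ne_zero] at this
  linarith

theorem abs_sin_le_two_mul (x : ℝ) : |Real.sin x| ≤ 2 * |Real.sin (x / 2)| := by
  have h : Real.sin x = 2 * Real.sin (x / 2) * Real.cos (x / 2) := by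
    rw [← Real.sin_two_mul, mul_div_cancel₀ x two_ne_zero]
  rw [h, abs_mul, abs_mul, abs_two]
  exact mul_le_of_le_one_right (by positivity) (Real.abs_cos_le_one _)

/-- The boundary values carry the small factor `sin (θ/2)` besides `N^{-1/2}`. Their squares are
thus `O(1/N)` times the local bias, as the relative localization condition requires. -/
theorem abs_taperSequence_one_le (N k : ℕ) :
    |taperSequence N k 1| ≤ √(2 / ((N : ℝ) + 1)) * (2 * |Real.sin (taperAngle N k / 2)|) := by
  unfold taperSequence
  rw [abs_mul, abs_of_nonneg (Real.sqrt_nonneg _), Nat.cast_one, one_mul]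
  gcongr
  exact abs_sin_le_two_mul _

theorem abs_taperSequence_last_le (N k : ℕ) :
    |taperSequence N k N| ≤ √(2 / ((N : ℝ) + 1)) * (2 * |Real.sin (taperAngle N k / 2)|) := by
  unfold taperSequence
  have e : (N : ℝ) * taperAngle N k = (N + 1) * taperAngle N k - taperAngle N k := by ring
  rw [abs_mul, abs_of_nonneg (Real.sqrt_nonneg _), e, Real.sin_sub, sin_succ_mul_taperAngle,
    zero_mul, zero_sub, abs_neg, abs_mul]
  exact mul_le_mul_of_nonneg_left ((mul_le_of_le_one_left (abs_nonneg _)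
    (Real.abs_cos_le_one _)).trans (abs_sin_le_two_mul _)) (Real.sqrt_nonneg _)

theorem localBias_sinusoidalTapers_bounds {N K : ℕ} (hK : K ≤ N) (k : Fin K) :
    4 * localBias (sinusoidalTapers N K k) ≤ Real.sin (taperAngle N k / 2) ^ 2 ∧
    Real.sin (taperAngle N k / 2) ^ 2 ≤ π ^ 2 * localBias (sinusoidalTapers N K k) := by
  have h := integral_sin_sq_mul_window_sq ((orthonormal_sinusoidalTapers hK).1 k)
    (sinusoidalTapers_apply k) (taperSequence_zero N k) (taperSequence_end N k)
    (taperSequence_recurrence N k)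
  rw [one_sub_cos_div_two_eq] at h
  rw [← h]
  exact ⟨localBias_le_integral_sin _, integral_sin_le_localBias _⟩

theorem localBiasBeyond_sinusoidalTapers_le {N K : ℕ} (hK : K ≤ N) (k : Fin K) {δ : ℝ} (hδ : 0 < δ) :
    256 * δ ^ 2 * localBiasBeyond (sinusoidalTapers N K k) δ ≤
      (32 * Real.sin (taperAngle N k / 2) ^ 2 + 64 / ((N : ℝ) + 1)) *
        Real.sin (taperAngle N k / 2) ^ 2 := by
  refine (localBiasBeyond_le_integral_sin _ hδ).trans
    ((integral_sin_pow_four_mul_window_sq_le ((orthonormal_sinusoidalTapers hK).1 k)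
    (sinusoidalTapers_apply k) (taperSequence_zero N k) (taperSequence_end N k)
    (taperSequence_recurrence N k)).trans ?_)
  have h1 := pow_le_pow_left₀ (by positivity)
    (add_le_add (abs_taperSequence_one_le N k) (abs_taperSequence_last_le N k)) 2
  have h2 : √(2 / ((N : ℝ) + 1)) ^ 2 = 2 / ((N : ℝ) + 1) := Real.sq_sqrt (by positivity)
  have h3 : (√(2 / ((N : ℝ) + 1)) * (2 * |Real.sin (taperAngle N k / 2)|) +
      √(2 / ((N : ℝ) + 1)) * (2 * |Real.sin (taperAngle N k / 2)|)) ^ 2 =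
      32 / ((N : ℝ) + 1) * Real.sin (taperAngle N k / 2) ^ 2 := by
    rw [← sq_abs (Real.sin _)]
    calc _ = 16 * √(2 / ((N : ℝ) + 1)) ^ 2 * |Real.sin (taperAngle N k / 2)| ^ 2 := by ring
      _ = _ := by rw [h2]; ring
  rw [h3] at h1
  have h4 : 2 - 2 * Real.cos (taperAngle N k) = 4 * Real.sin (taperAngle N k / 2) ^ 2 := by
    linarith [one_sub_cos_div_two_eq (taperAngle N k)]
  rw [h4]
  calc _ ≤ 2 * (4 * Real.sin (taperAngle N k / 2) ^ 2) ^ 2 +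
        2 * (32 / ((N : ℝ) + 1) * Real.sin (taperAngle N k / 2) ^ 2) := by gcongr
    _ = _ := by ring

/-- Few sinusoidal tapers are localized near zero frequency. -/
theorem isLocalized_sinusoidalTapers {N K : ℕ} (μ : Fin K → ℝ) {δ ρ : ℝ} (hδ : 0 < δ)
    (hρ1 : ρ ≤ 1) (hρδ : ρ ≤ δ) (hρδ3 : 6 * ρ ≤ δ ^ 3) (hK : (K : ℝ) ≤ ρ * N) :
    K ≤ N ∧ IsLocalized (sinusoidalTapers N K) μ δ := by
  have hN0 : (0 : ℝ) ≤ N := Nat.cast_nonneg N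
  have hKN : K ≤ N := by
    have : (K : ℝ) ≤ N := hK.trans (mul_le_of_le_one_left hN0 hρ1)
    exact_mod_cast this
  have hpi : π ^ 2 ≤ 10 := by nlinarith [Real.pi_lt_d2, Real.pi_pos]
  have hN1 : (0 : ℝ) < (N : ℝ) + 1 := by positivity
  have hρ : ∀ k : Fin K, 0 < ρ := fun k => by
    have : (0 : ℝ) < K := by exact_mod_cast k.pos
    by_contra h
    nlinarith
  -- The existence of an index forces `1 ≤ K ≤ ρN`, so small `K/N` also makes `1/N` small.
  have hinv : ∀ k : Fin K, 1 / ((N : ℝ) + 1) ≤ ρ := fun k => by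
    have h1 : (1 : ℝ) ≤ K := by exact_mod_cast k.pos
    rw [div_le_iff₀ hN1]
    nlinarith [hρ k]
  have hs : ∀ k : Fin K, Real.sin (taperAngle N k / 2) ^ 2 ≤ 5 / 2 * ρ := fun k => by
    have h1 : taperAngle N k ≤ π * ρ := by
      unfold taperAngle
      rw [div_le_iff₀ hN1, mul_assoc]
      have h2 : ((k : ℕ) : ℝ) + 1 ≤ K := by exact_mod_cast k.2
      gcongr
      nlinarith [hρ k]
    have h3 := pow_le_pow_left₀ (abs_nonneg _) (Real.abs_sin_le_abs (x := taperAngle N k / 2)) 2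
    rw [sq_abs, sq_abs, div_pow] at h3
    have h4 := pow_le_pow_left₀ (taperAngle_pos N k).le h1 2
    have h5 : ρ ^ 2 ≤ ρ := by nlinarith [hρ k]
    have h6 : (π * ρ) ^ 2 ≤ 10 * ρ := by
      rw [mul_pow]
      exact mul_le_mul hpi h5 (sq_nonneg _) (by norm_num)
    linarith
  refine ⟨hKN, fun k => ?_, ?_⟩
  · have := (localBias_sinusoidalTapers_bounds hKN k).1
    linarith [hs k, hρ k]
  · rw [Finset.mul_sum]
    refine Finset.sum_le_sum fun k _ => ?_
    have hb := localBiasBeyond_sinusoidalTapers_le hKN k hδ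
    have hl := (localBias_sinusoidalTapers_bounds hKN k).2
    have hi := hinv k
    have hsk := hs k
    have hρk := hρ k
    have hs0 : 0 ≤ Real.sin (taperAngle N k / 2) ^ 2 := sq_nonneg _
    have hL := localBias_nonneg (sinusoidalTapers N K k)
    set s := Real.sin (taperAngle N k / 2) ^ 2
    have h64 : 64 / ((N : ℝ) + 1) ≤ 64 * ρ := by
      rw [← mul_one_div]; gcongr
    -- Using `s ≤ 5ρ/2` and `s ≤ 10 λ`, the constant is `(80 + 64) · 10 = 1440`, and `1440ρ ≤ 240δ³`
    -- since `6ρ ≤ δ³`.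
    have key : 256 * δ ^ 2 * localBiasBeyond (sinusoidalTapers N K k) δ ≤
        256 * δ ^ 2 * (δ * localBias (sinusoidalTapers N K k)) := by
      calc _ ≤ (32 * s + 64 / ((N : ℝ) + 1)) * s := hb
        _ ≤ (32 * (5 / 2 * ρ) + 64 * ρ) * (10 * localBias (sinusoidalTapers N K k)) := by
            gcongr
            exact hl.trans (by gcongr)
        _ = 1440 * ρ * localBias (sinusoidalTapers N K k) := by ring
        _ ≤ 256 * δ ^ 3 * localBias (sinusoidalTapers N K k) := by
            gcongr ?_ * _
            linarith
        _ = _ := by ring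
    have := le_of_mul_le_mul_left key (by positivity)
    calc _ ≤ |μ k| * (δ * localBias (sinusoidalTapers N K k)) := by gcongr
      _ = _ := by ring

/-! ### Assembling bias and variance -/

theorem integral_sq_sub_const_eq {Ω : Type*} [MeasurableSpace Ω] {P : Measure Ω}
    [IsProbabilityMeasure P] {Z : Ω → ℝ} (hZ : MemLp Z 2 P) (s : ℝ) :
    Integrable (fun ω => (Z ω - s) ^ 2) P ∧
      ∫ ω, (Z ω - s) ^ 2 ∂P = (∫ ω, Z ω ∂P - s) ^ 2 + Var[Z; P] := by
  refine ⟨(hZ.sub (memLp_const s)).integrable_sq, ?_⟩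
  have h1 : ∀ ω, (Z ω - s) ^ 2 = Z ω ^ 2 - (2 * s) * Z ω + s ^ 2 := fun ω => by ring
  have i1 : Integrable (fun ω => Z ω ^ 2) P := hZ.integrable_sq
  have i2 : Integrable (fun ω => (2 * s) * Z ω) P := (hZ.integrable one_le_two).const_mul _
  have i3 : Integrable (fun ω => Z ω ^ 2 - (2 * s) * Z ω) P := i1.sub i2
  simp only [h1]
  rw [integral_add i3 (integrable_const _), integral_sub i1 i2, integral_const_mul,
    variance_eq_sub hZ]
  simp
  ring

theorem abs_sum_mul_le_of_forall {K : ℕ} (μ : Fin K → ℝ) {b : Fin K → ℝ} {c : Fin K → ℝ}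
    (h : ∀ k, |b k| ≤ c k) : |∑ k, μ k * b k| ≤ ∑ k, |μ k| * c k := by
  refine (Finset.abs_sum_le_sum_abs _ _).trans (Finset.sum_le_sum fun k _ => ?_)
  rw [abs_mul]
  exact mul_le_mul_of_nonneg_left (h k) (abs_nonneg _)

theorem abs_sq_sub_sq_le {b l r m Λ : ℝ} (hΛ : 0 ≤ Λ) (hr : 0 ≤ r) (hbl : |b - l| ≤ r * Λ)
    (hl : |l| ≤ m * Λ) : |b ^ 2 - l ^ 2| ≤ r * (r + 2 * m) * Λ ^ 2 := by
  have h1 : |b + l| ≤ (r + 2 * m) * Λ := by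
    calc |b + l| = |(b - l) + 2 * l| := by congr 1; ring
      _ ≤ |b - l| + |2 * l| := abs_add_le _ _
      _ ≤ r * Λ + 2 * (m * Λ) := by rw [abs_mul, abs_two]; gcongr
      _ = _ := by ring
  calc |b ^ 2 - l ^ 2| = |b - l| * |b + l| := by rw [← abs_mul]; congr 1; ring
    _ ≤ (r * Λ) * ((r + 2 * m) * Λ) := by gcongr
    _ = _ := by ring

theorem localBiasBeyond_antitone {N : ℕ} (v : EuclideanSpace ℝ (Fin N)) :
    Antitone (localBiasBeyond v) := fun ρ δ h => by
  have hi : IntegrableOn (fun h : ℝ => h ^ 2 * ‖window v h‖ ^ 2) (Icc (-(1 / 2)) (1 / 2)) :=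
    Continuous.integrableOn_Icc (by fun_prop)
  exact setIntegral_mono_set (hi.mono_set sdiff_subset) (.of_forall fun h => by positivity)
    (sdiff_subset_sdiff_right (Icc_subset_Icc (neg_le_neg h) h)).eventuallyLE

theorem IsLocalized.mono {N K : ℕ} {v : Fin K → EuclideanSpace ℝ (Fin N)} {μ : Fin K → ℝ}
    {ρ δ : ℝ} (hv : IsLocalized v μ ρ) (h : ρ ≤ δ) : IsLocalized v μ δ := by
  refine ⟨fun k => (hv.1 k).trans h, ?_⟩
  calc ∑ k, |μ k| * localBiasBeyond (v k) δ ≤ ∑ k, |μ k| * localBiasBeyond (v k) ρ := by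
        gcongr with k
        exact localBiasBeyond_antitone (v k) h
    _ ≤ ρ * ∑ k, |μ k| * localBias (v k) := hv.2
    _ ≤ δ * ∑ k, |μ k| * localBias (v k) := by
        gcongr
        exact Finset.sum_nonneg fun k _ => mul_nonneg (abs_nonneg _) (localBias_nonneg _)

/-- The square error expansion for localized tapers. -/
theorem exists_lossApprox_of_isLocalized {Ω : Type*} [MeasurableSpace Ω] (P : Measure Ω)
    [IsProbabilityMeasure P] (x : ℤ → Ω → ℝ) (S : ℝ → ℝ)
    (hS : ContDiffOn ℝ 2 S (Icc (-(1 / 2 : ℝ)) (1 / 2))) (hx : IsStationaryGaussian P x S)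
    (η : ℝ) (hη : 0 < η) (ε : ℝ) (hε : 0 < ε) :
    ∃ δ : ℝ, 0 < δ ∧ ∀ (N K : ℕ) (v : Fin K → EuclideanSpace ℝ (Fin N)) (μ : Fin K → ℝ),
      Orthonormal ℝ v → ∑ k, μ k = 1 → IsLocalized v μ δ →
      ∀ f : ℝ, η ≤ |f| → |f| ≤ 1 / 2 - η → LossApprox P x S v μ f ε := by
  obtain ⟨B, L, M, C, hB0, hL0, hM0, hC0, hB, hM, hL, hexp⟩ := exists_uniform_expansion hS hη
  -- Once `C * δ ≤ w`, the relative bias error `w + C * δ` is at most `min 1 (ε/(M+1))`. The squared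
  -- bias is then off by at most `ε/(M+1) · (1 + M) = ε` times `Λ²`.
  set w : ℝ := min 1 (ε / (M + 1)) / 2 with hw
  have hmin : 0 < min 1 (ε / (M + 1)) := by positivity
  have hw0 : 0 < w := by positivity
  obtain ⟨δ₀, hδ₀, hexp⟩ := hexp w hw0
  set C₁ : ℝ := 2 * B * L + L ^ 2 + 2 * ((B / (2 * η)) ^ 2 + B ^ 2) with hC₁
  have hC₁0 : 0 ≤ C₁ := by positivity
  -- `δ ≤ 1` lets `δ` be absorbed into `√δ`, `w/(C+1)` serves the bias, and the squared term gives
  -- `C₁√δ ≤ ε` for the variance.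
  set δ : ℝ := min (min δ₀ 1) (min (w / (C + 1)) ((ε / (C₁ + 1)) ^ 2)) with hδ
  have hδ0 : 0 < δ := by positivity
  have hδδ₀ : δ ≤ δ₀ := (min_le_left _ _).trans (min_le_left _ _)
  have hδ1 : δ ≤ 1 := (min_le_left _ _).trans (min_le_right _ _)
  have hδw : δ ≤ w / (C + 1) := (min_le_right _ _).trans (min_le_left _ _)
  have hδε : δ ≤ (ε / (C₁ + 1)) ^ 2 := (min_le_right _ _).trans (min_le_right _ _)
  have hvar : C₁ * √δ ≤ ε := by
    have h1 : √δ ≤ ε / (C₁ + 1) := Real.sqrt_le_iff.2 ⟨by positivity, hδε⟩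
    rw [le_div_iff₀ (by positivity)] at h1
    nlinarith [Real.sqrt_nonneg δ]
  have hbias : (w + C * δ) * (w + C * δ + M) ≤ ε := by
    have h1 : C * δ ≤ w := by
      rw [le_div_iff₀ (by positivity)] at hδw
      nlinarith
    have h2 : w + C * δ ≤ 1 := by linarith [min_le_left 1 (ε / (M + 1))]
    have h3 : w + C * δ ≤ ε / (M + 1) := by linarith [min_le_right 1 (ε / (M + 1))]
    have h4 : 0 ≤ w + C * δ := by positivity
    calc _ ≤ ε / (M + 1) * (1 + M) := by gcongr
      _ = ε := by field_simp; ring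
  -- a continuous extension of the spectral density
  set T : ℝ → ℝ := IccExtend (by norm_num : (-(1 / 2 : ℝ)) ≤ 1 / 2)
    ((Icc (-(1 / 2 : ℝ)) (1 / 2)).domRestrict S)
  have hT : Continuous T :=
    (continuousOn_iff_continuous_domRestrict.1 hS.continuousOn).Icc_extend'
  have hTS : ∀ g ∈ Icc (-(1 / 2 : ℝ)) (1 / 2), T g = S g := fun g hg => IccExtend_of_mem _ _ hg
  refine ⟨δ, hδ0, fun N K v μ hv hμ ⟨hloc₁, hloc₂⟩ f hf₁ hf₂ => ?_⟩
  have hfI : f ∈ Icc (-(1 / 2 : ℝ)) (1 / 2) := by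
    have := abs_le.1 hf₂
    exact ⟨by linarith, by linarith⟩
  obtain ⟨hint, heq⟩ := integral_sq_sub_const_eq (memLp_estimate hx.gaussian v μ f) (S f)
  refine ⟨hint, heq, ?_⟩
  set Λ : ℝ := ∑ k, localBias (v k) * |μ k| with hΛ
  have hΛ0 : 0 ≤ Λ := Finset.sum_nonneg fun k _ =>
    mul_nonneg (localBias_nonneg _) (abs_nonneg _)
  have hΛ' : ∑ k, |μ k| * localBias (v k) = Λ := Finset.sum_congr rfl fun k _ => mul_comm _ _
  set D := iteratedDeriv 2 S f with hD
  -- the bias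
  have hb : |∫ ω, estimate x v μ f ω ∂P - S f - 1 / 2 * D * ∑ k, localBias (v k) * μ k| ≤
      (w + C * δ) * Λ := by
    obtain ⟨s₁, hs₁⟩ := hexp δ hδδ₀ f hf₂
    have h1 : ∀ k, |(spectralForm T (v k) (v k) f).re - S f - 1 / 2 * D * localBias (v k)| ≤
        w * localBias (v k) + C * localBiasBeyond (v k) δ := fun k => by
      rw [← hTS f hfI]
      refine abs_spectralForm_self_sub_le (s₁ := s₁) (hv.1 k) hT fun g hg => ?_
      rw [hTS f hfI, hTS g hg]
      exact hs₁ g hg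
    have h2 := abs_sum_mul_le_of_forall μ h1
    have h3 : ∑ k, μ k * ((spectralForm T (v k) (v k) f).re - S f -
        1 / 2 * D * localBias (v k)) =
        ∫ ω, estimate x v μ f ω ∂P - S f - 1 / 2 * D * ∑ k, localBias (v k) * μ k := by
      rw [integral_estimate_eq_spectralForm hx hT hTS]
      -- Weights summing to one distribute `S f` over the tapers, reducing the bias to the
      -- single-taper expansions.
      have h4 : S f = ∑ k, μ k * S f := by rw [← Finset.sum_mul, hμ, one_mul]
      conv_rhs => rw [h4]
      rw [Finset.mul_sum, ← Finset.sum_sub_distrib, ← Finset.sum_sub_distrib]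
      exact Finset.sum_congr rfl fun k _ => by ring
    rw [h3] at h2
    refine h2.trans ?_
    have h5 : ∑ k, |μ k| * (w * localBias (v k) + C * localBiasBeyond (v k) δ) =
        w * Λ + C * ∑ k, |μ k| * localBiasBeyond (v k) δ := by
      rw [← hΛ', Finset.mul_sum, Finset.mul_sum, ← Finset.sum_add_distrib]
      exact Finset.sum_congr rfl fun k _ => by ring
    rw [hΛ'] at hloc₂
    rw [h5]
    calc _ ≤ w * Λ + C * (δ * Λ) := by gcongr
      _ = _ := by ring
  have hl : |1 / 2 * D * ∑ k, localBias (v k) * μ k| ≤ M / 2 * Λ := by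
    have h1 : |∑ k, localBias (v k) * μ k| ≤ Λ := by
      refine (Finset.abs_sum_le_sum_abs _ _).trans_eq (Finset.sum_congr rfl fun k _ => ?_)
      rw [abs_mul, abs_of_nonneg (localBias_nonneg _)]
    rw [abs_mul, abs_mul, abs_of_pos (by norm_num : (0 : ℝ) < 1 / 2)]
    calc _ ≤ 1 / 2 * M * Λ := by
          gcongr
          exact hM f hf₂
      _ = _ := by ring
  have hbsq := abs_sq_sub_sq_le hΛ0 (by positivity) hb hl
  rw [mul_div_cancel₀ M two_ne_zero] at hbsq
  -- the variance
  have hTf : T f = S f := hTS f hfI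
  have hBT : ∀ g ∈ Icc (-(1 / 2 : ℝ)) (1 / 2), |T g| ≤ B := fun g hg => by
    rw [hTS g hg]; exact hB g hg
  have hv₁ := abs_sum_spectralForm_sub_le hv hT (hBT f hfI) hL0 (fun g hg => by
    rw [hTS g hg, hTf]; exact hL f hf₂ g hg) hδ0 hloc₁ μ
  have hv₂ := sum_pseudoSpectralForm_le hv hT hη hf₁ hf₂ hBT hδ0 hloc₁ μ
  rw [hTf] at hv₁
  have hμ2 : 0 ≤ ∑ k, μ k ^ 2 := Finset.sum_nonneg fun k _ => sq_nonneg _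
  have hv : |Var[estimate x v μ f; P] - S f ^ 2 * ∑ k, μ k ^ 2| ≤ ε * ∑ k, μ k ^ 2 := by
    rw [variance_estimate_eq_spectralForm hx hT hTS]
    simp only [mul_add, Finset.sum_add_distrib]
    rw [add_sub_right_comm]
    refine (abs_add_le _ _).trans ((add_le_add hv₁ hv₂).trans ?_)
    rw [← add_mul]
    refine mul_le_mul_of_nonneg_right (le_trans ?_ hvar) hμ2
    have h1 : δ ≤ √δ := by
      calc δ = √δ * √δ := (Real.mul_self_sqrt hδ0.le).symm
        _ ≤ √δ * 1 := mul_le_mul_of_nonneg_left (Real.sqrt_le_one.2 hδ1) (Real.sqrt_nonneg δ)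
        _ = √δ := mul_one _
    have h2 : L ^ 2 * δ ≤ L ^ 2 * √δ := by gcongr
    calc _ ≤ 2 * B * L * √δ + L ^ 2 * √δ + 2 * ((B / (2 * η)) ^ 2 + B ^ 2) * √δ := by gcongr
      _ = C₁ * √δ := by rw [hC₁]; ring
  rw [heq, leadingLoss]
  calc _ = |((∫ ω, estimate x v μ f ω ∂P - S f) ^ 2 -
        (1 / 2 * D * ∑ k, localBias (v k) * μ k) ^ 2) +
        (Var[estimate x v μ f; P] - S f ^ 2 * ∑ k, μ k ^ 2)| := by congr 1; ring
    _ ≤ (w + C * δ) * (w + C * δ + M) * Λ ^ 2 + ε * ∑ k, μ k ^ 2 :=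
        (abs_add_le _ _).trans (add_le_add hbsq hv)
    _ ≤ ε * Λ ^ 2 + ε * ∑ k, μ k ^ 2 := by gcongr
    _ = _ := by ring

end Multitaper

end
theorem mainTheorem9 {Ω : Type*} [MeasurableSpace Ω] (P : Measure Ω) [IsProbabilityMeasure P]
    (x : ℤ → Ω → ℝ) (S : ℝ → ℝ) (hS : ContDiffOn ℝ 2 S (Icc (-(1 / 2 : ℝ)) (1 / 2)))
    (hx : Multitaper.IsStationaryGaussian P x S)
    (η : ℝ) (hη : 0 < η) (ε : ℝ) (hε : 0 < ε) :
    ∃ δ : ℝ, 0 < δ ∧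
      -- arbitrary orthonormal tapers that are localized near zero frequency
      (∀ (N K : ℕ) (v : Fin K → EuclideanSpace ℝ (Fin N)) (μ : Fin K → ℝ),
        Orthonormal ℝ v → ∑ k, μ k = 1 → (K : ℝ) ≤ δ * N → Multitaper.IsLocalized v μ δ →
        ∀ f : ℝ, η ≤ |f| → |f| ≤ 1 / 2 - η → Multitaper.LossApprox P x S v μ f ε) ∧
      -- sinusoidal tapers, where small `K / N` is enough
      (∀ (N K : ℕ) (μ : Fin K → ℝ), ∑ k, μ k = 1 → (K : ℝ) ≤ δ * N →
        ∀ f : ℝ, η ≤ |f| → |f| ≤ 1 / 2 - η →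
          Multitaper.LossApprox P x S (Multitaper.sinusoidalTapers N K) μ f ε) := by
  obtain ⟨δ, hδ, h⟩ := Multitaper.exists_lossApprox_of_isLocalized P x S hS hx η hη ε hε
  -- One smaller threshold serves both claims: localization at the threshold implies it at `δ`, and
  -- `δ³/6` is the bound on `K/N` that makes sinusoidal tapers `δ`-localized.
  have hρ : 0 < min (min 1 δ) (δ ^ 3 / 6) := by positivity
  have hρδ : min (min 1 δ) (δ ^ 3 / 6) ≤ δ := (min_le_left _ _).trans (min_le_right _ _)
  have hρ1 : min (min 1 δ) (δ ^ 3 / 6) ≤ 1 := (min_le_left _ _).trans (min_le_left _ _)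
  have hρ3 : 6 * min (min 1 δ) (δ ^ 3 / 6) ≤ δ ^ 3 := by
    linarith [min_le_right (min 1 δ) (δ ^ 3 / 6)]
  refine ⟨min (min 1 δ) (δ ^ 3 / 6), hρ, fun N K v μ hv hμ _ hloc => h N K v μ hv hμ (hloc.mono hρδ),
    fun N K μ hμ hK => ?_⟩
  obtain ⟨hKN, hloc⟩ := Multitaper.isLocalized_sinusoidalTapers μ hδ hρ1 hρδ hρ3 hK
  exact h N K _ μ (Multitaper.orthonormal_sinusoidalTapers hKN) hμ hloc
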